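/- Let $q$ be a complex number with $|q|<1$. Write $(a;q)_n=\prod_{k=0}^{n-1}(1-aq^k)$ for $n\ge 0$, $(a;q)_\infty=\prod_{k\ge0}(1-aq^k)$, and $(a)_n=(a;q)_n$, $(a)_\infty=(a;q)_\infty$, with the usual convention $1/(q;q)_n=0$ for integers $n<0$ (and likewise with $q^2$ in place of $q$). In particular the terms below with $j>n_1$ or $j>n_2$ vanish, and so do the terms with $j=0$ in the third identity. Then all the series below converge absolutely, and \begin{equation}\tag{3.1}\sum_{j,n_1,n_2\ge0}\frac{(-1)^jq^{j^2+n_1^2+n_2^2+j+n_1+n_2}}{(q)_{n_1-j}(q)_{n_2-j}(q)_{n_1+n_2+1}(q^2;q^2)_j}=\frac{(-q)_\infty}{(q)_\infty}\sum_{n\ge0}\frac{q^{2n^2+2n}}{(-q)_{2n+1}},\end{equation} \begin{equation}\tag{3.2}\sum_{j,n_1,n_2\ge0}\frac{(-1)^j(-q)_{n_1}(-q)_{n_2}q^{j^2+n_1(n_1+1)/2+n_2(n_2+1)/2+j}}{(q)_{n_1-j}(q)_{n_2-j}(q)_{n_1+n_2+1}(q^2;q^2)_j}=\frac{(-q)_\infty(-q;q^2)_\infty}{(q)_\infty(q;q^2)_\infty}\sum_{n\ge0}\frac{q^{n^2+n}}{(-q;q^2)_{n+1}},\end{equation}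 \begin{equation}\tag{3.3}\sum_{j,n_1,n_2\ge0}\frac{(-1)^{n_1+n_2+j-1}(q;q^2)_{n_1}(q;q^2)_{n_2}(q^2;q^4)_{j-1}\,q^{2j^2+n_1^2+n_2^2}}{(q^2;q^2)_{n_1-j}(q^2;q^2)_{n_2-j}(q^2;q^2)_{n_1+n_2}(q^2;q^2)_{2j-1}}=\frac{(q;q^2)_\infty^2(q^4;q^4)_\infty}{(q^2;q^2)_\infty^2(-q^4;q^4)_\infty}\,\psi(q^4),\end{equation} where $\psi(q)=\sum_{n\ge1}\dfrac{q^{n(n+1)/2}}{(q;q^2)_n}$. -/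

import Mathlib

noncomputable section

namespace MixedMock

open Finset

/-- The finite `q`-Pochhammer symbol `(a;q)_n = (1-a)(1-aq)⋯(1-aq^(n-1))`, for `n : ℕ`. -/
def qPoch (a q : ℂ) (n : ℕ) : ℂ := ∏ k ∈ range n, (1 - a * q ^ k)

/-- The infinite `q`-Pochhammer symbol `(a;q)_∞ = ∏_{k ≥ 0} (1 - a q^k)`. -/
def qPochInf (a q : ℂ) : ℂ := ∏' k : ℕ, (1 - a * q ^ k)

/-- The infinite product `(a;q)_∞` converges for `|q| < 1`. -/
theorem multipliable_qPochInf (a q : ℂ) (hq : ‖q‖ < 1) :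
    Multipliable fun k : ℕ => 1 - a * q ^ k := by
  have h : Summable fun k : ℕ => ‖-(a * q ^ k)‖ := by
    simpa [norm_mul, norm_pow] using
      (summable_geometric_of_lt_one (norm_nonneg q) hq).mul_left ‖a‖
  simpa [sub_eq_add_neg] using multipliable_one_add_of_summable h

/-- `(a;q)_n` for an integer index `n`: the usual extension
`(a;q)_{-m} = 1 / ((1 - a q^(-1)) ⋯ (1 - a q^(-m)))` for `m > 0`. -/
def qPochInt (a q : ℂ) : ℤ → ℂ
  | Int.ofNat n => qPoch a q n
  | Int.negSucc m => 1 / ∏ k ∈ range (m + 1), (1 - a / q ^ (k + 1))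

/-- The reciprocal `1 / (q;q)_n` for an integer index `n`, with the universal convention
`1 / (q;q)_n = 0` for `n < 0`. -/
def recipQFac (q : ℂ) : ℤ → ℂ
  | Int.ofNat n => 1 / qPoch q q n
  | Int.negSucc _ => 0

/-- The `n`-th term `q^(n(n+1)/2) / (q;q²)_n` of `ψ(q)`, written with `n = m + 1`, `m ≥ 0`. -/
def psiTerm (q : ℂ) (m : ℕ) : ℂ :=
  q ^ ((m + 1) * (m + 2) / 2) / qPoch q (q ^ 2) (m + 1)

/-- The tenth order mock theta function `ψ(q) = ∑_{n ≥ 1} q^(n(n+1)/2) / (q;q²)_n`. -/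
def psi (q : ℂ) : ℂ := ∑' m : ℕ, psiTerm q m

/-- Summand, at `(j, n₁, n₂)`, of the first triple sum. -/
def term1 (q : ℂ) (j n₁ n₂ : ℕ) : ℂ :=
  q ^ (j ^ 2 + n₁ ^ 2 + n₂ ^ 2 + j + n₁ + n₂) * (-1) ^ j
    * recipQFac q ((n₁ : ℤ) - j) * recipQFac q ((n₂ : ℤ) - j)
    / (qPoch q q (n₁ + n₂ + 1) * qPoch (q ^ 2) (q ^ 2) j)

/-- Summand, at `(j, n₁, n₂)`, of the second triple sum. -/
def term2 (q : ℂ) (j n₁ n₂ : ℕ) : ℂ :=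
  qPoch (-q) q n₁ * qPoch (-q) q n₂
    * q ^ (j ^ 2 + n₁ * (n₁ + 1) / 2 + n₂ * (n₂ + 1) / 2 + j) * (-1) ^ j
    * recipQFac q ((n₁ : ℤ) - j) * recipQFac q ((n₂ : ℤ) - j)
    / (qPoch q q (n₁ + n₂ + 1) * qPoch (q ^ 2) (q ^ 2) j)

/-- Summand, at `(j, n₁, n₂)`, of the third triple sum; it vanishes for `j = 0`
because of the factor `1 / (q²;q²)_{2j-1}`. -/
def term3 (q : ℂ) (j n₁ n₂ : ℕ) : ℂ :=
  qPoch q (q ^ 2) n₁ * qPoch q (q ^ 2) n₂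
    * q ^ (2 * j ^ 2 + n₁ ^ 2 + n₂ ^ 2) * (-1) ^ ((n₁ : ℤ) + n₂ + j - 1)
    * qPochInt (q ^ 2) (q ^ 4) ((j : ℤ) - 1)
    * recipQFac (q ^ 2) ((n₁ : ℤ) - j) * recipQFac (q ^ 2) ((n₂ : ℤ) - j)
    * recipQFac (q ^ 2) (2 * (j : ℤ) - 1)
    / qPoch (q ^ 2) (q ^ 2) (n₁ + n₂)

end MixedMock

end

namespace MixedMock

open Finset Filter Topology

/-! ### Finite `q`-Pochhammer symbols -/

/-! All three identities are instances of one comparison of Bailey type. Write K(n,r) =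
1/((q)_{n-r}(aq)_{n+r}) and let β_n = ∑_r K(n,r) α_r.

Triple side: `sum_mul_baileyKer` gives ∑_j a^j q^{j²} K(j,r) / ((q)_{M-j}(q)_{N-j}(aq)_{M+N}) = a^r
q^{r²} K(M,r) K(N,r). Summing over j therefore decouples M from N, and each remaining weighted sum
is a limiting q-Gauss sum (`hasSum_baileyWeight_mul_baileyKer`). The triple sum becomes a product
times ∑_r a^r q^{r²} α_r (w_r/(d)_r)², where w is the Bailey weight.

Single side: a change of base (`sum_baileyKer_changeBase`, `sum_baileyKer_one_changeBase`) turns β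
into some β' whose α-side is α times an explicit factor, now in base q². The ordinary Bailey lemma
`hasSum_baileyWeight_mul` evaluates the weighted sum of β' as a product times a series in α. With
the right parameters the two series in α agree term by term, so only infinite products remain to be
compared.

The sequence α is never computed: inverting the triangular system gives its existence with at most
exponential growth, which the Gaussian factors absorb in every interchange of sums. All finite
evaluations rest on one homogeneous q-Chu–Vandermonde sum, `sum_qChuVandermonde`. Since `HasSum`
over ℕ × ℕ × ℕ in ℂ is unconditional, absolute convergence is included. -/

theorem qPoch_zero (a q : ℂ) : qPoch a q 0 = 1 := by simp [qPoch]

theorem qPoch_succ (a q : ℂ) (n : ℕ) : qPoch a q (n + 1) = qPoch a q n * (1 - a * q ^ n) := by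
  simp [qPoch, prod_range_succ]

theorem qPoch_add (a q : ℂ) (m n : ℕ) :
    qPoch a q (m + n) = qPoch a q m * qPoch (a * q ^ m) q n := by
  simp only [qPoch, prod_range_add]
  congr 1
  refine prod_congr rfl fun k _ => ?_
  rw [pow_add]; ring

theorem qPoch_succ' (a q : ℂ) (n : ℕ) :
    qPoch a q (n + 1) = (1 - a) * qPoch (a * q) q n := by
  rw [add_comm, qPoch_add]; simp [qPoch]

theorem qPoch_zero_left (q : ℂ) (n : ℕ) : qPoch 0 q n = 1 := by simp [qPoch]

theorem qPoch_two_mul (a q : ℂ) (n : ℕ) :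
    qPoch a q (2 * n) = qPoch a (q ^ 2) n * qPoch (a * q) (q ^ 2) n := by
  induction n with
  | zero => simp [qPoch]
  | succ n ih =>
    rw [show 2 * (n + 1) = 2 * n + 1 + 1 by ring, qPoch_succ, qPoch_succ, ih, qPoch_succ,
      qPoch_succ]
    simp only [← pow_mul]; ring

theorem qPoch_sq (a q : ℂ) (n : ℕ) :
    qPoch (a ^ 2) (q ^ 2) n = qPoch a q n * qPoch (-a) q n := by
  simp only [qPoch, ← prod_mul_distrib]
  refine prod_congr rfl fun k _ => ?_
  ring

theorem one_sub_mul_pow_ne_zero {a q : ℂ} (ha : ‖a‖ < 1) (hq : ‖q‖ < 1) (k : ℕ) :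
    1 - a * q ^ k ≠ 0 := by
  intro h
  have h1 : a * q ^ k = 1 := (sub_eq_zero.mp h).symm
  have h2 : ‖a * q ^ k‖ < 1 := by
    rw [norm_mul, norm_pow]
    calc ‖a‖ * ‖q‖ ^ k ≤ ‖a‖ * 1 := by
          gcongr; exact pow_le_one₀ (norm_nonneg _) hq.le
      _ < 1 := by simpa using ha
  rw [h1] at h2
  simp at h2

theorem qPoch_ne_zero {a q : ℂ} (ha : ‖a‖ < 1) (hq : ‖q‖ < 1) (n : ℕ) : qPoch a q n ≠ 0 :=
  prod_ne_zero_iff.mpr fun k _ => one_sub_mul_pow_ne_zero ha hq k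

/-! ### Infinite `q`-Pochhammer symbols -/

theorem tendsto_qPoch (a : ℂ) {q : ℂ} (hq : ‖q‖ < 1) :
    Tendsto (qPoch a q) atTop (𝓝 (qPochInf a q)) :=
  (multipliable_qPochInf a q hq).hasProd.tendsto_prod_nat

theorem qPochInf_ne_zero {a q : ℂ} (ha : ‖a‖ < 1) (hq : ‖q‖ < 1) : qPochInf a q ≠ 0 := by
  have h : Summable fun k : ℕ => ‖-(a * q ^ k)‖ := by
    simpa [norm_mul, norm_pow] using
      (summable_geometric_of_lt_one (norm_nonneg q) hq).mul_left ‖a‖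
  have := tprod_one_add_ne_zero_of_summable (f := fun k : ℕ => -(a * q ^ k))
    (fun k => by simpa [← sub_eq_add_neg] using one_sub_mul_pow_ne_zero ha hq k) h
  simpa [qPochInf, ← sub_eq_add_neg] using this

theorem qPochInf_eq_qPoch_mul (a : ℂ) {q : ℂ} (hq : ‖q‖ < 1) (m : ℕ) :
    qPochInf a q = qPoch a q m * qPochInf (a * q ^ m) q := by
  refine tendsto_nhds_unique ((tendsto_add_atTop_iff_nat m).mpr (tendsto_qPoch a hq)) ?_
  simp only [add_comm _ m, qPoch_add]
  exact (tendsto_qPoch _ hq).const_mul _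

theorem qPochInf_zero_left (q : ℂ) : qPochInf 0 q = 1 := by simp [qPochInf]

theorem norm_sq_lt_one {q : ℂ} (hq : ‖q‖ < 1) : ‖q ^ 2‖ < 1 := by
  rw [norm_pow]; exact pow_lt_one₀ (norm_nonneg _) hq two_ne_zero

theorem qPochInf_eq_mul_sq (a : ℂ) {q : ℂ} (hq : ‖q‖ < 1) :
    qPochInf a q = qPochInf a (q ^ 2) * qPochInf (a * q) (q ^ 2) := by
  have h2 : Tendsto (fun n : ℕ => 2 * n) atTop atTop :=
    tendsto_id.const_mul_atTop' (by norm_num)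
  refine tendsto_nhds_unique ((tendsto_qPoch a hq).comp h2) ?_
  have := (tendsto_qPoch a (norm_sq_lt_one hq)).mul (tendsto_qPoch (a * q) (norm_sq_lt_one hq))
  refine this.congr fun n => ?_
  simp [qPoch_two_mul]

theorem exists_norm_qPoch_le (a : ℂ) {q : ℂ} (hq : ‖q‖ < 1) :
    ∃ B : ℝ, 0 < B ∧ ∀ n, ‖qPoch a q n‖ ≤ B := by
  obtain ⟨B, hB⟩ := (tendsto_qPoch a hq).norm.bddAbove_range
  refine ⟨max B 1, by positivity, fun n => ?_⟩
  exact (hB ⟨n, rfl⟩).trans (le_max_left _ _)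

theorem exists_norm_inv_qPoch_le {a q : ℂ} (ha : ‖a‖ < 1) (hq : ‖q‖ < 1) :
    ∃ B : ℝ, 0 < B ∧ ∀ n, ‖(qPoch a q n)⁻¹‖ ≤ B := by
  obtain ⟨B, hB⟩ := ((tendsto_qPoch a hq).inv₀ (qPochInf_ne_zero ha hq)).norm.bddAbove_range
  refine ⟨max B 1, by positivity, fun n => ?_⟩
  exact (hB ⟨n, rfl⟩).trans (le_max_left _ _)

/-! ### Summability of Gaussian-type sequences -/

/-- Ratio test: consecutive terms have ratio G ρ^n, which tends to 0 however large G is. -/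
theorem summable_pow_mul_pow_choose (G : ℝ) {ρ : ℝ} (h0 : 0 ≤ ρ) (h1 : ρ < 1) :
    Summable fun n : ℕ => G ^ n * ρ ^ n.choose 2 := by
  refine summable_of_ratio_norm_eventually_le (r := 1 / 2) (by norm_num) ?_
  have ht : Tendsto (fun n : ℕ => |G| * ρ ^ n) atTop (𝓝 0) := by
    simpa using (tendsto_pow_atTop_nhds_zero_of_lt_one h0 h1).const_mul |G|
  filter_upwards [ht.eventually (ge_mem_nhds (show (0 : ℝ) < 1 / 2 by norm_num))] with n hn
  have e : G ^ (n + 1) * ρ ^ (n + 1).choose 2 = (G * ρ ^ n) * (G ^ n * ρ ^ n.choose 2) := by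
    rw [Nat.choose_succ_succ' n 1, Nat.choose_one_right]; ring
  rw [e, norm_mul]
  gcongr
  simpa [abs_of_nonneg h0] using hn

theorem summable_of_norm_le_pow_choose {f : ℕ → ℂ} (E G : ℝ) {ρ : ℝ} (h0 : 0 ≤ ρ) (h1 : ρ < 1)
    (h : ∀ n, ‖f n‖ ≤ E * (G ^ n * ρ ^ n.choose 2)) : Summable fun n => ‖f n‖ :=
  Summable.of_nonneg_of_le (fun _ => norm_nonneg _) h
    ((summable_pow_mul_pow_choose G h0 h1).mul_left E)

/-! ### The `q`-Chu–Vandermonde sum -/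

/-- The product `∏_{k < m} (D - C q^k)`, a homogeneous form of `(C/D;q)_m`. -/
def homPoch (D C q : ℂ) (m : ℕ) : ℂ := ∏ k ∈ range m, (D - C * q ^ k)

theorem homPoch_succ (D C q : ℂ) (m : ℕ) :
    homPoch D C q (m + 1) = homPoch D C q m * (D - C * q ^ m) := by
  simp [homPoch, prod_range_succ]

theorem homPoch_mul_left (x D C q : ℂ) (m : ℕ) :
    homPoch (x * D) (x * C) q m = x ^ m * homPoch D C q m := by
  induction m with
  | zero => simp [homPoch]
  | succ m ih => rw [homPoch_succ, homPoch_succ, ih]; ring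

theorem homPoch_eq_qPoch (D x q : ℂ) (m : ℕ) :
    homPoch D (D * x) q m = D ^ m * qPoch x q m := by
  induction m with
  | zero => simp [homPoch, qPoch]
  | succ m ih => rw [homPoch_succ, qPoch_succ, ih]; ring

theorem homPoch_zero_right (D q : ℂ) (m : ℕ) : homPoch D 0 q m = D ^ m := by
  simp [homPoch]

theorem homPoch_add (D C q : ℂ) (m n : ℕ) :
    homPoch D C q (m + n) = homPoch D C q m * homPoch D (C * q ^ m) q n := by
  simp only [homPoch, prod_range_add]
  congr 1
  refine prod_congr rfl fun k _ => ?_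
  rw [pow_add]; ring

theorem choose_two_succ (m : ℕ) : (m + 1).choose 2 = m.choose 2 + m := by
  rw [Nat.choose_succ_succ' m 1, Nat.choose_one_right]; ring

/-- Each factor is εCq^M - Cq^k = -Cq^k (1 - εq^{M-k}), so the product strips the top i factors from
(εq)_M. The case ε = 1 produces 1/(q)_{M-i}, and ε = -1 produces 1/(-q)_{M-i}. -/
theorem homPoch_mul_pow_sub (C ε q : ℂ) (M i : ℕ) (h : i ≤ M) :
    homPoch (ε * C * q ^ M) C q i * qPoch (ε * q) q (M - i) =
      (-C) ^ i * q ^ i.choose 2 * qPoch (ε * q) q M := by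
  induction i with
  | zero => simp [homPoch]
  | succ i ih =>
    obtain ⟨k, rfl⟩ := Nat.exists_eq_add_of_le h
    have ih' := ih (by omega)
    rw [show i + 1 + k - i = k + 1 by omega, qPoch_succ] at ih'
    rw [show i + 1 + k - (i + 1) = k by omega, homPoch_succ, choose_two_succ, pow_succ (-C),
      pow_add q (i.choose 2)]
    linear_combination (-C * q ^ i) * ih'

theorem one_sub_pow_succ_ne_zero {q : ℂ} (hq : ‖q‖ < 1) (k : ℕ) : 1 - q ^ (k + 1) ≠ 0 := by
  rw [pow_succ']; exact one_sub_mul_pow_ne_zero hq hq k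

theorem qPoch_self_succ (q : ℂ) (n : ℕ) :
    qPoch q q (n + 1) = qPoch q q n * (1 - q ^ (n + 1)) := by
  rw [qPoch_succ, pow_succ']

/-- The homogeneous form avoids the quotient C/D, so D = 0 and C = 0 are allowed. The induction
passes from (C, D) to (Cq, Dq), which is why both are generalized. -/
theorem sum_qChuVandermonde {q : ℂ} (hq : ‖q‖ < 1) (N : ℕ) (C D : ℂ) :
    ∑ m ∈ range (N + 1), (-1) ^ m * q ^ m.choose 2 * homPoch D C q m * qPoch (C * q ^ m) q (N - m) /
        (qPoch q q m * qPoch q q (N - m)) = qPoch D q N / qPoch q q N := by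
  induction N generalizing C D with
  | zero => simp [homPoch, qPoch]
  | succ N ih =>
    have hN := one_sub_pow_succ_ne_zero hq N
    have key := ih (C * q) (D * q)
    rw [qPoch_succ' D, qPoch_self_succ q N, eq_div_iff (mul_ne_zero (qPoch_ne_zero hq hq N) hN)]
    rw [eq_div_iff (qPoch_ne_zero hq hq N)] at key
    rw [← key, mul_comm (qPoch q q N), ← mul_assoc, ← mul_assoc]
    congr 1
    rw [sum_mul, mul_sum]
    -- A q-Pascal splitting: 1 - q^{N+1} = q^m (1 - q^{N+1-m}) + (1 - q^m). Each part cancels one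
    -- factor of the denominator; after shifting m in the second, the two add up to (1 - D) times
    -- the summand for N.
    have split : ∀ m ∈ range (N + 1 + 1),
        (-1) ^ m * q ^ m.choose 2 * homPoch D C q m * qPoch (C * q ^ m) q (N + 1 - m) /
          (qPoch q q m * qPoch q q (N + 1 - m)) * (1 - q ^ (N + 1)) =
        (-1) ^ m * q ^ m.choose 2 * homPoch D C q m * qPoch (C * q ^ m) q (N + 1 - m) /
          (qPoch q q m * qPoch q q (N + 1 - m)) * (q ^ m * (1 - q ^ (N + 1 - m))) +
        (-1) ^ m * q ^ m.choose 2 * homPoch D C q m * qPoch (C * q ^ m) q (N + 1 - m) /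
          (qPoch q q m * qPoch q q (N + 1 - m)) * (1 - q ^ m) := by
      intro m hm
      rw [← mul_add]
      congr 1
      have : q ^ (N + 1) = q ^ m * q ^ (N + 1 - m) := by
        rw [← pow_add]; congr 1; have := mem_range.mp hm; omega
      rw [this]; ring
    rw [sum_congr rfl split, sum_add_distrib, sum_range_succ, sum_range_succ' _ (N + 1)]
    simp only [Nat.sub_self, pow_zero, sub_self, mul_zero, add_zero]
    rw [← sum_add_distrib]
    refine sum_congr rfl fun m hm => ?_
    obtain ⟨k, rfl⟩ := Nat.exists_eq_add_of_le (Nat.lt_succ_iff.mp (mem_range.mp hm))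
    rw [show m + k + 1 - m = k + 1 by omega, show m + k + 1 - (m + 1) = k by omega,
      show m + k - m = k by omega, qPoch_succ' (C * q ^ m), qPoch_self_succ, qPoch_self_succ,
      homPoch_succ, choose_two_succ, mul_comm D q, mul_comm C q, homPoch_mul_left,
      show C * q ^ m * q = q * C * q ^ m by ring, show C * q ^ (m + 1) = q * C * q ^ m by ring]
    have h1 := one_sub_pow_succ_ne_zero hq k
    have h2 := one_sub_pow_succ_ne_zero hq m
    have h3 := qPoch_ne_zero hq hq k
    have h4 := qPoch_ne_zero hq hq m
    field_simp
    ring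

/-! ### The limiting `q`-Gauss sum -/

/-- `1/(q;q)_{n-r}`, understood as `0` for `r > n`. -/
noncomputable def invFac (q : ℂ) (n r : ℕ) : ℂ := if r ≤ n then (qPoch q q (n - r))⁻¹ else 0

theorem invFac_of_lt {q : ℂ} {n r : ℕ} (h : n < r) : invFac q n r = 0 := by
  simp [invFac, not_le.mpr h]

theorem invFac_add_left (q : ℂ) (n r : ℕ) : invFac q (r + n) r = (qPoch q q n)⁻¹ := by
  simp [invFac]

theorem invFac_add_add (q : ℂ) (n r i : ℕ) : invFac q (r + n) (r + i) = invFac q n i := by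
  simp [invFac, Nat.add_sub_add_left]

theorem recipQFac_sub (q : ℂ) (n r : ℕ) : recipQFac q ((n : ℤ) - r) = invFac q n r := by
  by_cases h : r ≤ n
  · obtain ⟨k, rfl⟩ := Nat.exists_eq_add_of_le h
    rw [invFac_add_left, show ((r + k : ℕ) : ℤ) - r = Int.ofNat k by simp]
    simp [recipQFac]
  · push Not at h
    obtain ⟨k, rfl⟩ := Nat.exists_eq_add_of_lt h
    rw [invFac_of_lt h, show (n : ℤ) - ((n + k + 1 : ℕ) : ℤ) = Int.negSucc k by
      rw [Int.negSucc_eq]; push_cast; ring]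
    rfl

theorem exists_norm_invFac_le {q : ℂ} (hq : ‖q‖ < 1) :
    ∃ B : ℝ, 0 < B ∧ ∀ n r, ‖invFac q n r‖ ≤ B := by
  obtain ⟨B, hB, h⟩ := exists_norm_inv_qPoch_le hq hq
  refine ⟨B, hB, fun n r => ?_⟩
  unfold invFac
  split_ifs
  · exact h _
  · simpa using hB.le

theorem norm_homPoch_le (D C : ℂ) {q : ℂ} (hq : ‖q‖ < 1) (m : ℕ) :
    ‖homPoch D C q m‖ ≤ (‖D‖ + ‖C‖) ^ m := by
  unfold homPoch
  rw [norm_prod]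
  refine (prod_le_prod (fun _ _ => norm_nonneg _) (g := fun _ => ‖D‖ + ‖C‖) fun k _ => ?_).trans
    (by simp)
  refine (norm_sub_le _ _).trans ?_
  rw [norm_mul, norm_pow]
  gcongr
  exact mul_le_of_le_one_right (norm_nonneg _) (pow_le_one₀ (norm_nonneg _) hq.le)

theorem tendsto_qPoch_mul_invFac {q : ℂ} (hq : ‖q‖ < 1) (m : ℕ) :
    Tendsto (fun N => qPoch q q N * invFac q N m) atTop (𝓝 1) := by
  have h := (tendsto_qPoch q hq).mul
    (((tendsto_qPoch q hq).inv₀ (qPochInf_ne_zero hq hq)).comp (tendsto_sub_atTop_nat m))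
  rw [mul_inv_cancel₀ (qPochInf_ne_zero hq hq)] at h
  refine h.congr' ?_
  filter_upwards [eventually_ge_atTop m] with N hN
  simp [invFac, hN]

/-- Divide the finite sum by (C)_N and let N → ∞. The factor (q)_N/(q)_{N-m} is bounded and tends to
1, so dominated convergence applies. -/
theorem hasSum_qGauss_limit {q C : ℂ} (hq : ‖q‖ < 1) (hC : ‖C‖ < 1) (D : ℂ) :
    HasSum (fun m : ℕ => (-1) ^ m * q ^ m.choose 2 * homPoch D C q m / (qPoch q q m * qPoch C q m))
      (qPochInf D q / qPochInf C q) := by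
  set t : ℕ → ℂ := fun m =>
    (-1) ^ m * q ^ m.choose 2 * homPoch D C q m / (qPoch q q m * qPoch C q m) with ht
  obtain ⟨B₁, hB₁, h₁⟩ := exists_norm_inv_qPoch_le hq hq
  obtain ⟨B₂, hB₂, h₂⟩ := exists_norm_inv_qPoch_le hC hq
  obtain ⟨B₃, hB₃, h₃⟩ := exists_norm_qPoch_le q hq
  obtain ⟨B₄, hB₄, h₄⟩ := exists_norm_invFac_le hq
  have hts : Summable fun m => ‖t m‖ := by
    refine summable_of_norm_le_pow_choose (B₁ * B₂) (‖D‖ + ‖C‖) (norm_nonneg q) hq fun m => ?_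
    rw [ht]
    simp only [div_eq_mul_inv, mul_inv, norm_mul, norm_pow, norm_neg, norm_one, one_pow, one_mul]
    calc ‖q‖ ^ m.choose 2 * ‖homPoch D C q m‖ * (‖(qPoch q q m)⁻¹‖ * ‖(qPoch C q m)⁻¹‖)
        ≤ ‖q‖ ^ m.choose 2 * (‖D‖ + ‖C‖) ^ m * (B₁ * B₂) := by
          gcongr
          · exact norm_homPoch_le D C hq m
          · exact h₁ m
          · exact h₂ m
      _ = _ := by ring
  have hfin : ∀ N, ∑' m, qPoch q q N * invFac q N m * t m = qPoch D q N / qPoch C q N := by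
    intro N
    rw [tsum_eq_sum (s := range (N + 1))]
    · have h := sum_qChuVandermonde hq N C D
      have hN := qPoch_ne_zero hq hq N
      have hCN := qPoch_ne_zero hC hq N
      rw [eq_div_iff hN] at h
      rw [eq_div_iff hCN, ← h, sum_mul, sum_mul]
      refine sum_congr rfl fun m hm => ?_
      obtain ⟨k, rfl⟩ := Nat.exists_eq_add_of_le (Nat.lt_succ_iff.mp (mem_range.mp hm))
      rw [invFac_add_left, Nat.add_sub_cancel_left, qPoch_add C, ht]
      have e1 := qPoch_ne_zero hq hq k
      have e2 := qPoch_ne_zero hq hq m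
      have e3 := qPoch_ne_zero hC hq m
      field_simp
    · intro m hm
      rw [invFac_of_lt (by simpa using hm)]; ring
  have hlim : Tendsto (fun N => ∑' m, qPoch q q N * invFac q N m * t m) atTop (𝓝 (∑' m, t m)) := by
    refine tendsto_tsum_of_dominated_convergence (bound := fun m => B₃ * B₄ * ‖t m‖)
      (hts.mul_left _) (fun m => ?_) (Eventually.of_forall fun N m => ?_)
    · simpa using (tendsto_qPoch_mul_invFac hq m).mul_const (t m)
    · rw [norm_mul, norm_mul]
      gcongr
      · exact h₃ N
      · exact h₄ N m
  have hlim' : Tendsto (fun N => ∑' m, qPoch q q N * invFac q N m * t m) atTop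
      (𝓝 (qPochInf D q / qPochInf C q)) := by
    simp only [hfin]
    exact (tendsto_qPoch D hq).div (tendsto_qPoch C hq) (qPochInf_ne_zero hC hq)
  rw [tendsto_nhds_unique hlim' hlim]
  exact hts.of_norm.hasSum

/-! ### The Bailey kernel -/

/-- The Bailey kernel `1/((q;q)_{n-r} (aq;q)_{n+r})`, which vanishes for `r > n`. -/
noncomputable def baileyKer (q a : ℂ) (n r : ℕ) : ℂ := invFac q n r / qPoch (a * q) q (n + r)

theorem baileyKer_of_lt {q a : ℂ} {n r : ℕ} (h : n < r) : baileyKer q a n r = 0 := by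
  simp [baileyKer, invFac_of_lt h]

theorem norm_mul_lt_one {q a : ℂ} (hq : ‖q‖ < 1) (ha : ‖a‖ ≤ 1) : ‖a * q‖ < 1 := by
  rw [norm_mul]
  exact (mul_le_of_le_one_left (norm_nonneg _) ha).trans_lt hq

theorem norm_mul_mul_pow_lt_one {q a : ℂ} (hq : ‖q‖ < 1) (ha : ‖a‖ ≤ 1) (k : ℕ) :
    ‖a * q * q ^ k‖ < 1 := by
  rw [norm_mul _ (q ^ k), norm_pow]
  exact (mul_le_of_le_one_right (norm_nonneg _) (pow_le_one₀ (norm_nonneg _) hq.le)).trans_lt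
    (norm_mul_lt_one hq ha)

theorem exists_norm_baileyKer_le {q a : ℂ} (hq : ‖q‖ < 1) (ha : ‖a‖ ≤ 1) :
    ∃ B : ℝ, 0 < B ∧ ∀ n r, ‖baileyKer q a n r‖ ≤ B := by
  obtain ⟨B₁, hB₁, h₁⟩ := exists_norm_invFac_le hq
  obtain ⟨B₂, hB₂, h₂⟩ := exists_norm_inv_qPoch_le (norm_mul_lt_one hq ha) hq
  refine ⟨B₁ * B₂, by positivity, fun n r => ?_⟩
  rw [baileyKer, div_eq_mul_inv, norm_mul]
  gcongr
  · exact h₁ n r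
  · exact h₂ _

theorem sum_range_add_of_zero {f : ℕ → ℂ} (r m : ℕ) (h : ∀ i < r, f i = 0) :
    ∑ i ∈ range (r + m + 1), f i = ∑ i ∈ range (m + 1), f (r + i) := by
  rw [add_assoc, sum_range_add, sum_eq_zero fun i hi => h i (mem_range.mp hi), zero_add]

theorem two_mul_choose_two_add (i : ℕ) : 2 * i.choose 2 + i = i ^ 2 := by
  induction i with
  | zero => rfl
  | succ i ih => rw [choose_two_succ]; linarith [ih]

theorem choose_two_add (r i : ℕ) : (r + i).choose 2 = r.choose 2 + i.choose 2 + r * i := by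
  induction i with
  | zero => simp
  | succ i ih => rw [← add_assoc, choose_two_succ, choose_two_succ, ih]; ring

theorem homPoch_mul_pow (C q : ℂ) (hq : ‖q‖ < 1) (n i : ℕ) :
    homPoch (C * q ^ n) C q i = (-C) ^ i * q ^ i.choose 2 * qPoch q q n * invFac q n i := by
  by_cases h : i ≤ n
  · have := homPoch_mul_pow_sub C 1 q n i h
    rw [one_mul, one_mul] at this
    rw [invFac, if_pos h, ← this]
    have := qPoch_ne_zero hq hq (n - i)
    field_simp
  · rw [invFac_of_lt (by omega), mul_zero]
    exact prod_eq_zero (mem_range.mpr (by omega : n < i)) (sub_self _)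

/-- With j = r + i, M = r + m, N = r + n and C = aq^{2r+1}, this is q-Chu–Vandermonde of length m at
D = Cq^n. Its value (Cq^n)_m cancels the last m factors of (aq)_{M+N}, leaving a product of two
kernels. -/
theorem sum_mul_baileyKer {q a : ℂ} (hq : ‖q‖ < 1) (ha : ‖a‖ ≤ 1) (M N r : ℕ) :
    ∑ j ∈ range (M + 1), a ^ j * q ^ j ^ 2 *
        (invFac q M j * invFac q N j / qPoch (a * q) q (M + N)) * baileyKer q a j r =
      a ^ r * q ^ r ^ 2 * baileyKer q a M r * baileyKer q a N r := by
  by_cases hM : r ≤ M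
  swap
  · rw [baileyKer_of_lt (n := M) (by omega), mul_zero, zero_mul]
    refine sum_eq_zero fun j hj => ?_
    rw [baileyKer_of_lt (by have := mem_range.mp hj; omega), mul_zero]
  by_cases hN : r ≤ N
  swap
  · rw [baileyKer_of_lt (n := N) (by omega), mul_zero]
    refine sum_eq_zero fun j _ => ?_
    by_cases hj : j < r
    · rw [baileyKer_of_lt hj, mul_zero]
    · rw [invFac_of_lt (n := N) (by omega)]; ring
  obtain ⟨m, rfl⟩ := Nat.exists_eq_add_of_le hM
  obtain ⟨n, rfl⟩ := Nat.exists_eq_add_of_le hN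
  rw [sum_range_add_of_zero r m fun i hi => by rw [baileyKer_of_lt hi, mul_zero]]
  set C := a * q * q ^ (2 * r) with hC
  have hC1 : ‖C‖ < 1 := norm_mul_mul_pow_lt_one hq ha _
  have hCmn : qPoch (a * q) q (r + m + (r + n)) =
      qPoch (a * q) q (2 * r) * (qPoch C q n * qPoch (C * q ^ n) q m) := by
    rw [← qPoch_add C, hC, ← qPoch_add]; congr 1; ring
  have hCk : ∀ k, qPoch (a * q) q (r + k + r) = qPoch (a * q) q (2 * r) * qPoch C q k := by
    intro k; rw [hC, ← qPoch_add]; congr 1; ring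
  have e0 : qPoch (a * q) q (2 * r) ≠ 0 := qPoch_ne_zero (norm_mul_lt_one hq ha) hq _
  have em := qPoch_ne_zero hC1 hq m
  have en := qPoch_ne_zero hC1 hq n
  have eq := qPoch_ne_zero hq hq
  have emn : qPoch (C * q ^ n) q m ≠ 0 :=
    qPoch_ne_zero (norm_mul_mul_pow_lt_one (a := a * q ^ (2 * r + n)) hq (by
      rw [norm_mul, norm_pow]
      exact mul_le_one₀ ha (by positivity) (pow_le_one₀ (norm_nonneg _) hq.le)) 0 |>.trans_eq' (by
        congr 1; rw [hC]; ring)) hq m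
  have cv := sum_qChuVandermonde hq m C (C * q ^ n)
  have hterm : ∀ i ∈ range (m + 1),
      a ^ (r + i) * q ^ (r + i) ^ 2 * (invFac q (r + m) (r + i) * invFac q (r + n) (r + i) /
        qPoch (a * q) q (r + m + (r + n))) * baileyKer q a (r + i) r =
      a ^ r * q ^ r ^ 2 / (qPoch (a * q) q (r + m + (r + n)) * qPoch (a * q) q (2 * r) *
        qPoch C q m * qPoch q q n) *
      ((-1) ^ i * q ^ i.choose 2 * homPoch (C * q ^ n) C q i * qPoch (C * q ^ i) q (m - i) /
        (qPoch q q i * qPoch q q (m - i))) := by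
    intro i hi
    obtain ⟨k, rfl⟩ := Nat.exists_eq_add_of_le (Nat.lt_succ_iff.mp (mem_range.mp hi))
    rw [baileyKer, invFac_add_add, invFac_add_add, invFac_add_left, invFac_add_left, hCk,
      Nat.add_sub_cancel_left, homPoch_mul_pow C q hq, hCmn]
    rw [qPoch_add C q i k] at em ⊢
    have ei := left_ne_zero_of_mul em
    have ek := right_ne_zero_of_mul em
    have e1 := eq i
    have e2 := eq k
    have e3 := eq n
    have hpow : a ^ (r + i) * q ^ (r + i) ^ 2 =
        a ^ r * q ^ r ^ 2 * ((-1) ^ i * q ^ i.choose 2 * ((-C) ^ i * q ^ i.choose 2)) := by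
      have : (-1 : ℂ) ^ i * (-C) ^ i = C ^ i := by rw [← mul_pow]; ring
      calc a ^ (r + i) * q ^ (r + i) ^ 2
          = a ^ r * q ^ r ^ 2 * (C ^ i * q ^ (2 * i.choose 2)) := by
            rw [show (r + i) ^ 2 = r ^ 2 + 2 * r * i + i ^ 2 by ring,
              ← two_mul_choose_two_add i, hC]
            ring
        _ = _ := by rw [← this]; ring
    rw [hpow]
    field_simp
  rw [sum_congr rfl hterm, ← mul_sum, cv, baileyKer, baileyKer, invFac_add_left, invFac_add_left,
    hCmn, hCk, hCk]
  have e1 := eq m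
  have e2 := eq n
  field_simp

/-! ### Change of base -/

/-- q-Chu–Vandermonde at D = -Cq^m: the homogeneous product supplies 1/(-q)_{m-i}, which merges with
1/(q)_{m-i} into base q². -/
theorem sum_changeBase {q C : ℂ} (hq : ‖q‖ < 1) (hC : ‖C‖ < 1) (m : ℕ) :
    ∑ i ∈ range (m + 1), C ^ i * q ^ (2 * i.choose 2) /
        (qPoch (q ^ 2) (q ^ 2) (m - i) * qPoch q q i * qPoch C q i) =
      qPoch (-(C * q ^ m)) q m / (qPoch (q ^ 2) (q ^ 2) m * qPoch C q m) := by
  have cv := sum_qChuVandermonde hq m C (-(C * q ^ m))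
  have hn : ‖-q‖ < 1 := by rwa [norm_neg]
  have em := qPoch_ne_zero hC hq m
  have e1 := qPoch_ne_zero hq hq m
  have e2 := qPoch_ne_zero hn hq m
  have hterm : ∀ i ∈ range (m + 1), C ^ i * q ^ (2 * i.choose 2) /
        (qPoch (q ^ 2) (q ^ 2) (m - i) * qPoch q q i * qPoch C q i) =
      1 / (qPoch C q m * qPoch (-q) q m) *
      ((-1) ^ i * q ^ i.choose 2 * homPoch (-(C * q ^ m)) C q i * qPoch (C * q ^ i) q (m - i) /
        (qPoch q q i * qPoch q q (m - i))) := by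
    intro i hi
    have him := Nat.lt_succ_iff.mp (mem_range.mp hi)
    have f1 := qPoch_ne_zero hq hq i
    have f2 := qPoch_ne_zero hq hq (m - i)
    have f3 := qPoch_ne_zero hn hq (m - i)
    have f4 := qPoch_ne_zero hC hq i
    have hp := homPoch_mul_pow_sub C (-1) q m i him
    rw [neg_one_mul, neg_one_mul, neg_mul, ← eq_div_iff f3] at hp
    have hs : qPoch C q m = qPoch C q i * qPoch (C * q ^ i) q (m - i) := by
      rw [← qPoch_add, Nat.add_sub_cancel' him]
    have f5 : qPoch (C * q ^ i) q (m - i) ≠ 0 := by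
      rw [hs] at em; exact right_ne_zero_of_mul em
    have hC' : C ^ i = (-1) ^ i * (-C) ^ i := by rw [← mul_pow]; ring
    rw [qPoch_sq, hs, hp, hC', two_mul, pow_add]
    field_simp
  rw [sum_congr rfl hterm, ← mul_sum, cv, qPoch_sq]
  field_simp

theorem sum_changeBase_shifted {q c : ℂ} (hq : ‖q‖ < 1) (hc : ‖c‖ < 1) (m : ℕ) :
    (1 + c * q ^ m) * ∑ i ∈ range (m + 1), c ^ i * q ^ (2 * i.choose 2) /
        (qPoch (q ^ 2) (q ^ 2) (m - i) * qPoch q q i * qPoch (c * q) q i) =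
      (1 + c) * qPoch (-(c * q ^ m)) q m / (qPoch (q ^ 2) (q ^ 2) m * qPoch (c * q) q m) := by
  cases m with
  | zero => simp [qPoch]
  | succ m =>
    have hq2 := norm_sq_lt_one hq
    have hc1 : 1 - c ≠ 0 := by simpa using one_sub_mul_pow_ne_zero hc hq 0
    have hcq : ‖c * q‖ < 1 := norm_mul_lt_one hq hc.le
    have hcq2 : ‖c * q ^ 2‖ < 1 := norm_mul_lt_one hq2 hc.le
    have h1 := sum_changeBase hq hc (m + 1)
    have h2 := sum_changeBase hq hcq2 m
    -- Termwise, (1 - c)/(cq)_i = (1 - c)/(c)_i - c(1 - q^i)/(cq)_i. The factor 1 - q^i shortens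
    -- (q)_i, so the correction, after shifting i, is the sum of length m with parameter cq².
    have hsplit : (1 - c) * ∑ i ∈ range (m + 1 + 1), c ^ i * q ^ (2 * i.choose 2) /
          (qPoch (q ^ 2) (q ^ 2) (m + 1 - i) * qPoch q q i * qPoch (c * q) q i) =
        (1 - c) * ∑ i ∈ range (m + 1 + 1), c ^ i * q ^ (2 * i.choose 2) /
          (qPoch (q ^ 2) (q ^ 2) (m + 1 - i) * qPoch q q i * qPoch c q i) -
        c ^ 2 / (1 - c * q) * ∑ i ∈ range (m + 1), (c * q ^ 2) ^ i * q ^ (2 * i.choose 2) /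
          (qPoch (q ^ 2) (q ^ 2) (m - i) * qPoch q q i * qPoch (c * q ^ 2) q i) := by
      rw [eq_sub_iff_add_eq, sum_range_succ' _ (m + 1), sum_range_succ' _ (m + 1), mul_add, mul_add,
        add_right_comm, mul_sum, mul_sum, mul_sum, ← sum_add_distrib]
      congr 1
      · refine sum_congr rfl fun i _ => ?_
        rw [show m + 1 - (i + 1) = m - i by omega, qPoch_self_succ, choose_two_succ,
          qPoch_succ' c, qPoch_succ (c * q) q i]
        have f0 := qPoch_ne_zero hq2 hq2 (m - i)
        have f1 := qPoch_ne_zero hq hq i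
        have f2 := one_sub_pow_succ_ne_zero hq i
        have f3 := qPoch_ne_zero hcq hq i
        have f4 := one_sub_mul_pow_ne_zero hcq hq i
        have f5 : 1 - c * q ≠ 0 := by simpa using one_sub_mul_pow_ne_zero hcq hq 0
        have f6 : (1 - c * q) * qPoch (c * q ^ 2) q i = qPoch (c * q) q i * (1 - c * q * q ^ i) := by
          rw [← qPoch_succ, qPoch_succ']; congr 2; ring
        have f7 : qPoch (c * q ^ 2) q i ≠ 0 := qPoch_ne_zero hcq2 hq i
        have f8 : c ^ 2 / (1 - c * q) * ((c * q ^ 2) ^ i * q ^ (2 * i.choose 2) /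
            (qPoch (q ^ 2) (q ^ 2) (m - i) * qPoch q q i * qPoch (c * q ^ 2) q i)) =
            c ^ 2 * (c * q ^ 2) ^ i * q ^ (2 * i.choose 2) /
            (qPoch (q ^ 2) (q ^ 2) (m - i) * qPoch q q i *
              (qPoch (c * q) q i * (1 - c * q * q ^ i))) := by
          rw [← f6]; field_simp
        rw [f8]
        field_simp
        ring
    refine mul_left_cancel₀ hc1 ?_
    rw [mul_left_comm, hsplit, h1, h2]
    have e1 : qPoch (-(c * q ^ (m + 1))) q (m + 1) =
        (1 + c * q ^ (m + 1)) * qPoch (-(c * q ^ (m + 2))) q m := by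
      rw [qPoch_succ']; congr 1
      · ring
      · congr 1; ring
    have e2 : qPoch (-(c * q ^ 2 * q ^ m)) q m = qPoch (-(c * q ^ (m + 2))) q m := by
      congr 1; ring
    have e3 : (1 - c * q) * qPoch (c * q ^ 2) q m = qPoch (c * q) q m * (1 - c * q * q ^ m) := by
      rw [← qPoch_succ, qPoch_succ']; congr 2; ring
    have f1 := qPoch_ne_zero hq2 hq2 m
    have f2 := one_sub_pow_succ_ne_zero hq2 m
    have f3 := qPoch_ne_zero hcq hq m
    have f4 := one_sub_mul_pow_ne_zero hcq hq m
    have f5 : 1 - c * q ≠ 0 := by simpa using one_sub_mul_pow_ne_zero hcq hq 0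
    have f6 : qPoch (c * q ^ 2) q m ≠ 0 := qPoch_ne_zero hcq2 hq m
    have e4 : ∀ x : ℂ, c ^ 2 / (1 - c * q) * (x / (qPoch (q ^ 2) (q ^ 2) m * qPoch (c * q ^ 2) q m))
        = c ^ 2 * x / (qPoch (q ^ 2) (q ^ 2) m * (qPoch (c * q) q m * (1 - c * q * q ^ m))) := by
      intro x; rw [← e3]; field_simp
    rw [e2, e4, e1, qPoch_succ' c, qPoch_succ (c * q), qPoch_self_succ]
    field_simp
    ring

/-- After k = r + i this is `sum_changeBase` with C = aq^{2r+1}; the factors (aq)_{n+r} and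
(-aq)_{n+r} combine into (a²q²;q²)_{n+r}. -/
theorem sum_baileyKer_changeBase {q a : ℂ} (hq : ‖q‖ < 1) (ha : ‖a‖ ≤ 1) (n r : ℕ) :
    ∑ k ∈ range (n + 1), a ^ k * q ^ k ^ 2 * invFac (q ^ 2) n k / qPoch (-(a * q)) q (2 * n) *
        baileyKer q a k r = a ^ r * q ^ r ^ 2 * baileyKer (q ^ 2) (a ^ 2) n r := by
  by_cases hr : r ≤ n
  swap
  · rw [baileyKer_of_lt (by omega), mul_zero]
    refine sum_eq_zero fun j hj => ?_
    rw [baileyKer_of_lt (by have := mem_range.mp hj; omega), mul_zero]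
  obtain ⟨m, rfl⟩ := Nat.exists_eq_add_of_le hr
  rw [sum_range_add_of_zero r m fun i hi => by rw [baileyKer_of_lt hi, mul_zero]]
  set C := a * q * q ^ (2 * r) with hC
  have hC1 : ‖C‖ < 1 := norm_mul_mul_pow_lt_one hq ha _
  have haq := norm_mul_lt_one hq ha
  have hnaq : ‖-(a * q)‖ < 1 := by rwa [norm_neg]
  have e0 : qPoch (a * q) q (2 * r) ≠ 0 := qPoch_ne_zero haq hq _
  have en : qPoch (-(a * q)) q (2 * (r + m)) ≠ 0 := qPoch_ne_zero hnaq hq _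
  have hCk : ∀ k, qPoch (a * q) q (r + k + r) = qPoch (a * q) q (2 * r) * qPoch C q k := by
    intro k; rw [hC, ← qPoch_add]; congr 1; ring
  have hterm : ∀ i ∈ range (m + 1), a ^ (r + i) * q ^ (r + i) ^ 2 *
        invFac (q ^ 2) (r + m) (r + i) / qPoch (-(a * q)) q (2 * (r + m)) *
        baileyKer q a (r + i) r =
      a ^ r * q ^ r ^ 2 / (qPoch (-(a * q)) q (2 * (r + m)) * qPoch (a * q) q (2 * r)) *
      (C ^ i * q ^ (2 * i.choose 2) /
        (qPoch (q ^ 2) (q ^ 2) (m - i) * qPoch q q i * qPoch C q i)) := by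
    intro i hi
    have him := Nat.lt_succ_iff.mp (mem_range.mp hi)
    have hpow : a ^ (r + i) * q ^ (r + i) ^ 2 =
        a ^ r * q ^ r ^ 2 * (C ^ i * q ^ (2 * i.choose 2)) := by
      rw [show (r + i) ^ 2 = r ^ 2 + 2 * r * i + i ^ 2 by ring, ← two_mul_choose_two_add i, hC]
      ring
    rw [baileyKer, invFac_add_add, invFac_add_left, hCk, hpow, invFac, if_pos him]
    simp only [div_eq_mul_inv, mul_inv]
    ring
  have h1 : qPoch (-(a * q)) q (2 * (r + m)) =
      qPoch (-(a * q)) q (r + m + r) * qPoch (-(C * q ^ m)) q m := by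
    rw [show 2 * (r + m) = r + m + r + m by ring, qPoch_add _ _ (r + m + r), hC]
    congr 2; ring
  have h2 : qPoch (a ^ 2 * q ^ 2) (q ^ 2) (r + m + r) =
      qPoch (a * q) q (2 * r) * qPoch C q m * qPoch (-(a * q)) q (r + m + r) := by
    rw [← hCk, ← qPoch_sq, mul_pow]
  rw [sum_congr rfl hterm, ← mul_sum, sum_changeBase hq hC1, baileyKer, invFac_add_left, h2]
  rw [h1] at en ⊢
  have e1 := left_ne_zero_of_mul en
  have e2 := right_ne_zero_of_mul en
  field_simp

/-- Here c = q^{2r} in `sum_changeBase_shifted`, which needs ‖c‖ < 1 and hence r ≠ 0. The omitted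
case is harmless in the application, where α_0 = β_0 = 0. -/
theorem sum_baileyKer_one_changeBase {q : ℂ} (hq : ‖q‖ < 1) (n : ℕ) {r : ℕ} (hr0 : r ≠ 0) :
    ∑ k ∈ range (n + 1), q ^ (2 * k.choose 2) * invFac (q ^ 2) n k / qPoch (-1) q (2 * n) *
        baileyKer q 1 k r =
      q ^ (2 * r.choose 2) * (1 + q ^ (2 * r)) / 2 * baileyKer (q ^ 2) 1 n r := by
  by_cases hr : r ≤ n
  swap
  · rw [baileyKer_of_lt (by omega), mul_zero]
    refine sum_eq_zero fun j hj => ?_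
    rw [baileyKer_of_lt (by have := mem_range.mp hj; omega), mul_zero]
  obtain ⟨m, rfl⟩ := Nat.exists_eq_add_of_le hr
  rw [sum_range_add_of_zero r m fun i hi => by rw [baileyKer_of_lt hi, mul_zero]]
  set c := q ^ (2 * r) with hc
  have hn : ‖-q‖ < 1 := by rwa [norm_neg]
  have hc1 : ‖c‖ < 1 := by
    rw [hc, norm_pow]; exact pow_lt_one₀ (norm_nonneg _) hq (by omega)
  have e0 : qPoch q q (2 * r) ≠ 0 := qPoch_ne_zero hq hq _
  have hck : ∀ k, qPoch q q (r + k + r) = qPoch q q (2 * r) * qPoch (c * q) q k := by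
    intro k; rw [hc, mul_comm _ q, ← qPoch_add]; congr 1; ring
  have hterm : ∀ i ∈ range (m + 1), q ^ (2 * (r + i).choose 2) *
        invFac (q ^ 2) (r + m) (r + i) / qPoch (-1) q (2 * (r + m)) * baileyKer q 1 (r + i) r =
      q ^ (2 * r.choose 2) / (qPoch (-1) q (2 * (r + m)) * qPoch q q (2 * r)) *
      (c ^ i * q ^ (2 * i.choose 2) /
        (qPoch (q ^ 2) (q ^ 2) (m - i) * qPoch q q i * qPoch (c * q) q i)) := by
    intro i hi
    have him := Nat.lt_succ_iff.mp (mem_range.mp hi)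
    have hpow : q ^ (2 * (r + i).choose 2) =
        q ^ (2 * r.choose 2) * (c ^ i * q ^ (2 * i.choose 2)) := by
      rw [choose_two_add, hc]; ring
    rw [baileyKer, invFac_add_add, invFac_add_left, one_mul, hck, hpow, invFac, if_pos him]
    field_simp
  have hcm : 1 + c * q ^ m ≠ 0 := by
    simpa using one_sub_mul_pow_ne_zero (a := -c) (by rwa [norm_neg]) hq m
  have h1 : qPoch (-1) q (2 * (r + m)) * (1 + c * q ^ m) =
      2 * qPoch (-q) q (r + m + r) * qPoch (-(c * q ^ m)) q m := by
    have e : qPoch (-1) q (r + m + r) * (1 + c * q ^ m) = 2 * qPoch (-q) q (r + m + r) := by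
      have := qPoch_succ (-1) q (r + m + r)
      rw [qPoch_succ', neg_one_mul] at this
      rw [show c * q ^ m = q ^ (r + m + r) by rw [hc]; ring]
      linear_combination -this
    rw [show 2 * (r + m) = r + m + r + m by ring, qPoch_add _ _ (r + m + r),
      show -1 * q ^ (r + m + r) = -(c * q ^ m) by rw [hc]; ring]
    linear_combination qPoch (-(c * q ^ m)) q m * e
  have h2 : qPoch (q ^ 2) (q ^ 2) (r + m + r) =
      qPoch q q (2 * r) * qPoch (c * q) q m * qPoch (-q) q (r + m + r) := by
    rw [← hck, ← qPoch_sq]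
  have hmain := sum_changeBase_shifted hq hc1 m
  rw [mul_comm, ← eq_div_iff hcm] at hmain
  rw [sum_congr rfl hterm, ← mul_sum, hmain, baileyKer, invFac_add_left, one_mul, h2]
  have e1 := qPoch_ne_zero hn hq (r + m + r)
  have e2 : qPoch (-(c * q ^ m)) q m ≠ 0 := by
    refine qPoch_ne_zero ?_ hq m
    rw [norm_neg, norm_mul, norm_pow q m]
    exact (mul_le_of_le_one_right (norm_nonneg _)
      (pow_le_one₀ (norm_nonneg _) hq.le)).trans_lt hc1
  have e3 : qPoch (-1) q (2 * (r + m)) =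
      2 * qPoch (-q) q (r + m + r) * qPoch (-(c * q ^ m)) q m / (1 + c * q ^ m) := by
    rw [eq_div_iff hcm, h1]
  have e4 : qPoch (c * q) q m ≠ 0 := qPoch_ne_zero (norm_mul_lt_one hq hc1.le) hq m
  rw [e3]
  field_simp

/-! ### Weights of the Bailey lemma -/

/-- The weight `(aq/d;q)_M (-d)^M q^{M(M-1)/2}`, written so as to make sense for `d = 0`. -/
noncomputable def baileyWeight (q a d : ℂ) (M : ℕ) : ℂ :=
  (-1) ^ M * q ^ M.choose 2 * homPoch d (a * q) q M

theorem summable_norm_baileyWeight {q : ℂ} (hq : ‖q‖ < 1) (a d : ℂ) :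
    Summable fun M => ‖baileyWeight q a d M‖ := by
  refine summable_of_norm_le_pow_choose 1 (‖d‖ + ‖a * q‖) (norm_nonneg q) hq fun m => ?_
  rw [baileyWeight]
  simp only [norm_mul _ (homPoch d (a * q) q m), norm_mul _ (q ^ _), norm_pow, norm_neg, norm_one,
    one_pow, one_mul]
  rw [mul_comm]
  gcongr
  exact norm_homPoch_le _ _ hq m

theorem baileyWeight_add (q a d : ℂ) (r m : ℕ) :
    baileyWeight q a d (r + m) = baileyWeight q a d r *
      ((-1) ^ m * q ^ m.choose 2 * homPoch (d * q ^ r) (a * q * q ^ (2 * r)) q m) := by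
  rw [baileyWeight, baileyWeight, homPoch_add, choose_two_add, mul_comm d (q ^ r),
    show a * q * q ^ (2 * r) = q ^ r * (a * q * q ^ r) by ring, homPoch_mul_left]
  ring

/-- The terms M < r vanish; with M = r + m the rest is the limiting q-Gauss sum at C = aq^{2r+1}, D
= dq^r. -/
theorem hasSum_baileyWeight_mul_baileyKer {q a d : ℂ} (hq : ‖q‖ < 1) (ha : ‖a‖ ≤ 1)
    (hd : ‖d‖ < 1) (r : ℕ) :
    HasSum (fun M => baileyWeight q a d M * baileyKer q a M r)
      (qPochInf d q / qPochInf (a * q) q * (baileyWeight q a d r / qPoch d q r)) := by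
  have haq := norm_mul_lt_one hq ha
  rw [← hasSum_nat_add_iff' r, sum_eq_zero fun i hi => by
    rw [baileyKer_of_lt (mem_range.mp hi), mul_zero], sub_zero]
  have hC : ‖a * q * q ^ (2 * r)‖ < 1 := norm_mul_mul_pow_lt_one hq ha _
  have h := (hasSum_qGauss_limit hq hC (d * q ^ r)).mul_left
    (baileyWeight q a d r / qPoch (a * q) q (2 * r))
  have e0 := qPoch_ne_zero haq hq (2 * r)
  have e1 := qPoch_ne_zero hd hq r
  have e2 := qPochInf_ne_zero hC hq
  have hfun : ∀ m, baileyWeight q a d r / qPoch (a * q) q (2 * r) *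
      ((-1) ^ m * q ^ m.choose 2 * homPoch (d * q ^ r) (a * q * q ^ (2 * r)) q m /
        (qPoch q q m * qPoch (a * q * q ^ (2 * r)) q m)) =
      baileyWeight q a d (m + r) * baileyKer q a (m + r) r := by
    intro m
    rw [add_comm m r, baileyWeight_add, baileyKer, invFac_add_left,
      show r + m + r = 2 * r + m by ring, qPoch_add (a * q)]
    simp only [div_eq_mul_inv, mul_inv]
    ring
  simp only [hfun] at h
  have hval : qPochInf d q / qPochInf (a * q) q * (baileyWeight q a d r / qPoch d q r) =
      baileyWeight q a d r / qPoch (a * q) q (2 * r) *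
        (qPochInf (d * q ^ r) q / qPochInf (a * q * q ^ (2 * r)) q) := by
    rw [qPochInf_eq_qPoch_mul d hq r, qPochInf_eq_qPoch_mul (a * q) hq (2 * r)]
    field_simp
  rw [hval]
  exact h

/-! ### Inversion of a triangular system -/

/-- The solution `α` of the triangular system `β n = ∑_{r ≤ n} K n r * α r`. -/
noncomputable def triangularInv (K : ℕ → ℕ → ℂ) (β : ℕ → ℂ) : ℕ → ℂ
  | n => (β n - ∑ r : Fin n, K n r * triangularInv K β r) / K n n
decreasing_by exact r.2

theorem triangularInv_eq (K : ℕ → ℕ → ℂ) (β : ℕ → ℂ) (n : ℕ) :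
    triangularInv K β n = (β n - ∑ r ∈ range n, K n r * triangularInv K β r) / K n n := by
  rw [triangularInv, Finset.sum_range]

theorem sum_mul_triangularInv {K : ℕ → ℕ → ℂ} (hK : ∀ n, K n n ≠ 0) (β : ℕ → ℂ) (n : ℕ) :
    ∑ r ∈ range (n + 1), K n r * triangularInv K β r = β n := by
  rw [sum_range_succ, triangularInv_eq K β n, mul_div_cancel₀ _ (hK n)]
  ring

/-- The rate B B' + 1 makes the recursion close exactly: 1 + B B' ∑_{r<n} (B B' + 1)^r = (B B' +
1)^n. -/
theorem norm_triangularInv_le {K : ℕ → ℕ → ℂ} {β : ℕ → ℂ} {B B' b : ℝ} (hB : 0 ≤ B) (hb : 0 ≤ b)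
    (hB' : 0 ≤ B') (hK : ∀ n r, ‖K n r‖ ≤ B) (hK' : ∀ n, ‖(K n n)⁻¹‖ ≤ B') (hβ : ∀ n, ‖β n‖ ≤ b)
    (n : ℕ) : ‖triangularInv K β n‖ ≤ b * B' * (B * B' + 1) ^ n := by
  induction n using Nat.strong_induction_on with
  | _ n ih =>
    rw [triangularInv_eq, div_eq_mul_inv, norm_mul]
    have h1 : ‖∑ r ∈ range n, K n r * triangularInv K β r‖ ≤
        ∑ r ∈ range n, B * (b * B' * (B * B' + 1) ^ r) := by
      refine norm_sum_le_of_le _ fun r hr => ?_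
      rw [norm_mul]
      gcongr
      · exact hK n r
      · exact ih r (mem_range.mp hr)
    have h2 := geom_sum_mul (B * B' + 1) n
    rw [add_sub_cancel_right] at h2
    calc ‖β n - ∑ r ∈ range n, K n r * triangularInv K β r‖ * ‖(K n n)⁻¹‖
        ≤ (b + ∑ r ∈ range n, B * (b * B' * (B * B' + 1) ^ r)) * B' := by
          gcongr
          · exact (norm_sub_le _ _).trans (add_le_add (hβ n) h1)
          · exact hK' n
      _ = b * B' * (B * B' + 1) ^ n := by
          rw [← mul_sum, ← mul_sum]
          linear_combination b * B' * h2

/-- A bounded sequence is the `β`-side of a Bailey pair whose `α`-side grows at most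
exponentially. -/
theorem exists_baileyPair {q a : ℂ} (hq : ‖q‖ < 1) (ha : ‖a‖ ≤ 1) {β : ℕ → ℂ} {b : ℝ}
    (hβ : ∀ n, ‖β n‖ ≤ b) :
    ∃ α : ℕ → ℂ, (∀ n, ∑ r ∈ range (n + 1), baileyKer q a n r * α r = β n) ∧
      ∃ E G : ℝ, ∀ n, ‖α n‖ ≤ E * G ^ n := by
  have haq := norm_mul_lt_one hq ha
  have hdiag : ∀ n, baileyKer q a n n = (qPoch (a * q) q (n + n))⁻¹ := by
    intro n; simp [baileyKer, invFac, qPoch_zero]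
  obtain ⟨B, hB, hK⟩ := exists_norm_baileyKer_le hq ha
  obtain ⟨B', hB', hK'⟩ := exists_norm_qPoch_le (a * q) hq
  have hb : 0 ≤ b := (norm_nonneg _).trans (hβ 0)
  refine ⟨triangularInv (baileyKer q a) β, sum_mul_triangularInv (fun n => ?_) β,
    b * B', B * B' + 1,
    norm_triangularInv_le hB.le hb hB'.le hK (fun n => ?_) hβ⟩
  · rw [hdiag]; exact inv_ne_zero (qPoch_ne_zero haq hq _)
  · rw [hdiag, inv_inv]; exact hK' _

/-! ### Bailey lemmas -/

/-- The Bailey lemma with parameters ρ₁ = aq/d and ρ₂ → ∞; d = 0 corresponds to ρ₁ → ∞ as well. -/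
theorem hasSum_baileyWeight_mul {q a d : ℂ} (hq : ‖q‖ < 1) (ha : ‖a‖ ≤ 1) (hd : ‖d‖ < 1)
    {γ β : ℕ → ℂ} (hγ : Summable fun r => ‖γ r‖)
    (hβ : ∀ n, ∑ r ∈ range (n + 1), baileyKer q a n r * γ r = β n) :
    HasSum (fun n => baileyWeight q a d n * β n)
      (qPochInf d q / qPochInf (a * q) q *
        ∑' r, γ r * (baileyWeight q a d r / qPoch d q r)) := by
  obtain ⟨B, hB, hK⟩ := exists_norm_baileyKer_le hq ha
  set G : ℕ × ℕ → ℂ := fun x => γ x.1 * (baileyWeight q a d x.2 * baileyKer q a x.2 x.1) with hG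
  have hGs : Summable G := by
    refine Summable.of_norm_bounded
      (g := fun x : ℕ × ℕ => ‖γ x.1‖ * ‖baileyWeight q a d x.2‖ * B)
      ((hγ.mul_of_nonneg (summable_norm_baileyWeight hq a d) (fun _ => norm_nonneg _)
        (fun _ => norm_nonneg _)).mul_right B) fun x => ?_
    rw [hG, norm_mul, norm_mul, ← mul_assoc]
    gcongr
    exact hK _ _
  have h1 := hGs.hasSum.prod_fiberwise fun r =>
    (hasSum_baileyWeight_mul_baileyKer hq ha hd r).mul_left (γ r)
  have h2 : HasSum (fun n => baileyWeight q a d n * β n) (∑' x, G x) := by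
    refine ((Equiv.prodComm ℕ ℕ).hasSum_iff.mpr hGs.hasSum).prod_fiberwise fun n => ?_
    have e : baileyWeight q a d n * β n = ∑ r ∈ range (n + 1), G (r, n) := by
      rw [← hβ n, mul_sum]
      exact sum_congr rfl fun r _ => by rw [hG]; ring
    rw [e]
    refine hasSum_sum_of_ne_finset_zero fun r hr => ?_
    simp only [hG, Function.comp_apply, Equiv.prodComm_apply, Prod.swap_prod_mk]
    rw [baileyKer_of_lt (by simpa using hr)]
    ring
  convert h2 using 1
  rw [← h1.tsum_eq, ← tsum_mul_left]
  exact tsum_congr fun r => by ring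

theorem hasSum_triple_baileyWeight_mul {q a d : ℂ} (hq : ‖q‖ < 1) (ha : ‖a‖ ≤ 1) (hd : ‖d‖ < 1)
    {α β : ℕ → ℂ} (hα : Summable fun r => ‖a ^ r * q ^ r ^ 2 * α r‖)
    (hβs : Summable fun j => ‖a ^ j * q ^ j ^ 2 * β j‖)
    (hβ : ∀ n, ∑ r ∈ range (n + 1), baileyKer q a n r * α r = β n) :
    HasSum (fun x : ℕ × ℕ × ℕ => a ^ x.1 * q ^ x.1 ^ 2 * β x.1 *
        (baileyWeight q a d x.2.1 * baileyWeight q a d x.2.2 *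
          (invFac q x.2.1 x.1 * invFac q x.2.2 x.1 / qPoch (a * q) q (x.2.1 + x.2.2))))
      ((qPochInf d q / qPochInf (a * q) q) ^ 2 *
        ∑' r, a ^ r * q ^ r ^ 2 * α r * (baileyWeight q a d r / qPoch d q r) ^ 2) := by
  obtain ⟨B, hB, hK⟩ := exists_norm_baileyKer_le hq ha
  obtain ⟨B₁, hB₁, h₁⟩ := exists_norm_invFac_le hq
  obtain ⟨B₂, hB₂, h₂⟩ := exists_norm_inv_qPoch_le (norm_mul_lt_one hq ha) hq
  have hw := summable_norm_baileyWeight hq a d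
  have hww : Summable fun p : ℕ × ℕ => ‖baileyWeight q a d p.1‖ * ‖baileyWeight q a d p.2‖ :=
    hw.mul_of_nonneg hw (fun _ => norm_nonneg _) (fun _ => norm_nonneg _)
  set F : ℕ × ℕ × ℕ → ℂ := fun x => a ^ x.1 * q ^ x.1 ^ 2 * β x.1 *
        (baileyWeight q a d x.2.1 * baileyWeight q a d x.2.2 *
          (invFac q x.2.1 x.1 * invFac q x.2.2 x.1 / qPoch (a * q) q (x.2.1 + x.2.2))) with hF
  set G : ℕ × ℕ × ℕ → ℂ := fun x => a ^ x.1 * q ^ x.1 ^ 2 * α x.1 *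
        ((baileyWeight q a d x.2.1 * baileyKer q a x.2.1 x.1) *
          (baileyWeight q a d x.2.2 * baileyKer q a x.2.2 x.1)) with hG
  have hFs : Summable F := by
    refine Summable.of_norm_bounded
      (g := fun x : ℕ × ℕ × ℕ => ‖a ^ x.1 * q ^ x.1 ^ 2 * β x.1‖ *
        (‖baileyWeight q a d x.2.1‖ * ‖baileyWeight q a d x.2.2‖) * (B₁ * B₁ * B₂))
      ((hβs.mul_of_nonneg hww (fun _ => norm_nonneg _) (fun _ => by positivity)).mul_right _)
      fun x => ?_
    simp only [hF]
    rw [norm_mul _ (_ * (_ / _)), norm_mul _ (_ / _), norm_mul (baileyWeight q a d _),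
      div_eq_mul_inv, norm_mul _ (_⁻¹), norm_mul (invFac q _ _), ← mul_assoc]
    gcongr
    · exact h₁ _ _
    · exact h₁ _ _
    · exact h₂ _
  have hGs : Summable G := by
    refine Summable.of_norm_bounded
      (g := fun x : ℕ × ℕ × ℕ => ‖a ^ x.1 * q ^ x.1 ^ 2 * α x.1‖ *
        (‖baileyWeight q a d x.2.1‖ * ‖baileyWeight q a d x.2.2‖) * (B * B))
      ((hα.mul_of_nonneg hww (fun _ => norm_nonneg _) (fun _ => by positivity)).mul_right _)
      fun x => ?_
    simp only [hG]
    rw [norm_mul _ (_ * baileyKer _ _ _ _ * _), norm_mul (_ * baileyKer _ _ _ _),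
      norm_mul (baileyWeight q a d _), norm_mul (baileyWeight q a d _), mul_mul_mul_comm, ← mul_assoc]
    gcongr
    · exact hK _ _
    · exact hK _ _
  have hFp : HasSum (fun p : ℕ × ℕ => ∑ j ∈ range (p.1 + 1), F (j, p)) (∑' x, F x) := by
    refine ((Equiv.prodComm (ℕ × ℕ) ℕ).hasSum_iff.mpr hFs.hasSum).prod_fiberwise fun p => ?_
    refine hasSum_sum_of_ne_finset_zero fun j hj => ?_
    simp only [hF, Function.comp_apply, Equiv.prodComm_apply, Prod.swap_prod_mk]
    rw [invFac_of_lt (n := p.1) (by simpa using hj)]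
    ring
  have hGp : HasSum (fun p : ℕ × ℕ => ∑ r ∈ range (p.1 + 1), G (r, p)) (∑' x, G x) := by
    refine ((Equiv.prodComm (ℕ × ℕ) ℕ).hasSum_iff.mpr hGs.hasSum).prod_fiberwise fun p => ?_
    refine hasSum_sum_of_ne_finset_zero fun r hr => ?_
    simp only [hG, Function.comp_apply, Equiv.prodComm_apply, Prod.swap_prod_mk]
    rw [baileyKer_of_lt (n := p.1) (by simpa using hr)]
    ring
  -- For fixed (M, N) both inner sums are finite, and inserting the definition of β reduces their
  -- equality to the product formula for kernels.
  have hFG : ∀ p : ℕ × ℕ, ∑ j ∈ range (p.1 + 1), F (j, p) = ∑ r ∈ range (p.1 + 1), G (r, p) := by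
    rintro ⟨M, N⟩
    have hβ' : ∀ j ∈ range (M + 1), β j = ∑ r ∈ range (M + 1), baileyKer q a j r * α r := by
      intro j hj
      rw [← hβ j]
      refine sum_subset (range_subset_range.mpr (mem_range.mp hj)) fun r _ hr => ?_
      rw [baileyKer_of_lt (by simpa using hr), zero_mul]
    have hL : ∀ j ∈ range (M + 1), F (j, M, N) = ∑ r ∈ range (M + 1),
        α r * (baileyWeight q a d M * baileyWeight q a d N) * (a ^ j * q ^ j ^ 2 *
          (invFac q M j * invFac q N j / qPoch (a * q) q (M + N)) * baileyKer q a j r) := by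
      intro j hj
      simp only [hF]
      rw [hβ' j hj, mul_sum, sum_mul]
      exact sum_congr rfl fun r _ => by ring
    rw [sum_congr rfl hL, sum_comm]
    refine sum_congr rfl fun r _ => ?_
    rw [← mul_sum, sum_mul_baileyKer hq ha]
    simp only [hG]
    ring
  -- For fixed r the sum over (M, N) is a product of two identical single sums, whence the square.
  have hGr := hGs.hasSum.prod_fiberwise fun r =>
    ((hasSum_baileyWeight_mul_baileyKer hq ha hd r).mul
      (hasSum_baileyWeight_mul_baileyKer hq ha hd r) (by
        refine Summable.of_norm_bounded (hww.mul_right (B * B)) fun p => ?_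
        rw [norm_mul, norm_mul, norm_mul, mul_mul_mul_comm]
        gcongr
        · exact hK _ _
        · exact hK _ _)).mul_left (a ^ r * q ^ r ^ 2 * α r)
  have hval : ∑' x, F x = ∑' x, G x := by
    simp only [hFG] at hFp
    exact hFp.unique hGp
  convert hFs.hasSum using 1
  rw [hval, ← hGr.tsum_eq, ← tsum_mul_left]
  exact tsum_congr fun r => by ring

/-! ### Comparison of a triple sum with a single sum -/

theorem norm_pow_mul_pow_sq_le {q a : ℂ} (hq : ‖q‖ < 1) (ha : ‖a‖ ≤ 1) (r : ℕ) :
    ‖a ^ r * q ^ r ^ 2‖ ≤ ‖q‖ ^ r.choose 2 := by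
  rw [norm_mul, norm_pow, norm_pow]
  refine (mul_le_of_le_one_left (by positivity) (pow_le_one₀ (norm_nonneg _) ha)).trans ?_
  exact pow_le_pow_of_le_one (norm_nonneg _) hq.le (by have := two_mul_choose_two_add r; omega)

theorem summable_norm_mul_of_le {q : ℂ} (hq : ‖q‖ < 1) {w α : ℕ → ℂ} {E G : ℝ}
    (hw : ∀ r, ‖w r‖ ≤ ‖q‖ ^ r.choose 2) (hα : ∀ r, ‖α r‖ ≤ E * G ^ r) :
    Summable fun r => ‖w r * α r‖ := by
  refine summable_of_norm_le_pow_choose E G (norm_nonneg q) hq fun r => ?_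
  rw [norm_mul]
  calc ‖w r‖ * ‖α r‖ ≤ ‖q‖ ^ r.choose 2 * (E * G ^ r) := by
        gcongr
        · exact hw r
        · exact hα r
    _ = _ := by ring

/-- If a change of base takes `β` to `β'`, then the triple sum built from `β` and the single sum
built from `β'` are explicit multiples of one and the same series. -/
theorem exists_hasSum_triple_and_hasSum {q a d Q A D : ℂ} (hq : ‖q‖ < 1) (ha : ‖a‖ ≤ 1)
    (hd : ‖d‖ < 1) (hQ : ‖Q‖ < 1) (hA : ‖A‖ ≤ 1) (hD : ‖D‖ < 1) {β β' w : ℕ → ℂ} {c : ℕ → ℕ → ℂ}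
    {b : ℝ} (hβ : ∀ n, ‖β n‖ ≤ b) (hw : ∀ r, ‖w r‖ ≤ ‖q‖ ^ r.choose 2)
    (hker : ∀ n r, (r = 0 → β 0 ≠ 0) →
      ∑ k ∈ range (n + 1), c n k * baileyKer q a k r = w r * baileyKer Q A n r)
    (hβ' : ∀ n, ∑ k ∈ range (n + 1), c n k * β k = β' n)
    (hv : ∀ r, a ^ r * q ^ r ^ 2 * (baileyWeight q a d r / qPoch d q r) ^ 2 =
      w r * (baileyWeight Q A D r / qPoch D Q r)) :
    ∃ S : ℂ,
      HasSum (fun x : ℕ × ℕ × ℕ => a ^ x.1 * q ^ x.1 ^ 2 * β x.1 *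
        (baileyWeight q a d x.2.1 * baileyWeight q a d x.2.2 *
          (invFac q x.2.1 x.1 * invFac q x.2.2 x.1 / qPoch (a * q) q (x.2.1 + x.2.2))))
        ((qPochInf d q / qPochInf (a * q) q) ^ 2 * S) ∧
      HasSum (fun n => baileyWeight Q A D n * β' n)
        (qPochInf D Q / qPochInf (A * Q) Q * S) := by
  obtain ⟨α, hα, E, G, hαb⟩ := exists_baileyPair hq ha hβ
  have hα0 : α 0 = β 0 := by
    rw [← hα 0]; simp [baileyKer, invFac, qPoch_zero]
  have hpair : ∀ n, ∑ r ∈ range (n + 1), baileyKer Q A n r * (w r * α r) = β' n := by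
    intro n
    have h : ∀ k ∈ range (n + 1), c n k * β k =
        ∑ r ∈ range (n + 1), α r * (c n k * baileyKer q a k r) := by
      intro k hk
      rw [← hα k, mul_sum, sum_subset (range_subset_range.mpr (mem_range.mp hk))]
      · exact sum_congr rfl fun r _ => by ring
      · intro r _ hr
        rw [baileyKer_of_lt (by simpa using hr)]; ring
    rw [← hβ' n, sum_congr rfl h, sum_comm]
    refine sum_congr rfl fun r _ => ?_
    rw [← mul_sum]
    -- The kernel identity may fail to be available at r = 0 when β_0 = 0, but then α_0 = 0 kills
    -- the term.
    by_cases hr : r = 0 ∧ β 0 = 0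
    · obtain ⟨rfl, h0⟩ := hr
      rw [hα0, h0]; ring
    · rw [hker n r (fun h0 h1 => hr ⟨h0, h1⟩)]; ring
  have h1 := hasSum_triple_baileyWeight_mul hq ha hd
    (summable_norm_mul_of_le hq (norm_pow_mul_pow_sq_le hq ha) hαb)
    (summable_norm_mul_of_le hq (norm_pow_mul_pow_sq_le hq ha) (E := b) (G := 1)
      (fun r => by simpa using hβ r)) hα
  have h2 := hasSum_baileyWeight_mul hQ hA hD (summable_norm_mul_of_le hq hw hαb) hpair
  refine ⟨∑' r, w r * α r * (baileyWeight Q A D r / qPoch D Q r), ?_, h2⟩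
  have hS : ∑' r, w r * α r * (baileyWeight Q A D r / qPoch D Q r) =
      ∑' r, a ^ r * q ^ r ^ 2 * α r * (baileyWeight q a d r / qPoch d q r) ^ 2 :=
    tsum_congr fun r => by linear_combination -α r * hv r
  rw [hS]
  exact h1

/-! ### Special weights -/

theorem homPoch_zero_left (C q : ℂ) (m : ℕ) : homPoch 0 C q m = (-C) ^ m * q ^ m.choose 2 := by
  induction m with
  | zero => simp [homPoch]
  | succ m ih => rw [homPoch_succ, ih, choose_two_succ]; ring

theorem baileyWeight_zero (q a : ℂ) (M : ℕ) : baileyWeight q a 0 M = a ^ M * q ^ M ^ 2 := by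
  rw [baileyWeight, homPoch_zero_left, ← two_mul_choose_two_add M]
  have : (-1 : ℂ) ^ M * (-(a * q)) ^ M = a ^ M * q ^ M := by rw [← mul_pow, ← mul_pow]; ring
  linear_combination q ^ (2 * M.choose 2) * this

theorem baileyWeight_of_eq_mul {q a d x : ℂ} (h : a * q = d * x) (M : ℕ) :
    baileyWeight q a d M = (-d) ^ M * q ^ M.choose 2 * qPoch x q M := by
  rw [baileyWeight, h, homPoch_eq_qPoch, neg_pow d]
  ring

theorem qPochInf_sq {q : ℂ} (hq : ‖q‖ < 1) (a : ℂ) :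
    qPochInf (a ^ 2) (q ^ 2) = qPochInf a q * qPochInf (-a) q := by
  refine tendsto_nhds_unique (tendsto_qPoch _ (norm_sq_lt_one hq)) ?_
  exact ((tendsto_qPoch a hq).mul (tendsto_qPoch (-a) hq)).congr fun n => (qPoch_sq a q n).symm

theorem qPochInf_succ {q : ℂ} (hq : ‖q‖ < 1) (a : ℂ) :
    qPochInf a q = (1 - a) * qPochInf (a * q) q := by
  simpa [qPoch] using qPochInf_eq_qPoch_mul a hq 1

theorem one_add_ne_zero {q : ℂ} (hq : ‖q‖ < 1) : 1 + q ≠ 0 := by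
  simpa using one_sub_mul_pow_ne_zero (a := -q) (by rwa [norm_neg]) hq 0

theorem one_sub_ne_zero {q : ℂ} (hq : ‖q‖ < 1) : 1 - q ≠ 0 := by
  simpa using one_sub_mul_pow_ne_zero hq hq 0

/-! ### The first two identities -/

/-- q-Chu–Vandermonde in base q² at C = 0, D = q², where the right-hand side is 1. -/
theorem sum_alternating_changeBase {q : ℂ} (hq : ‖q‖ < 1) (n : ℕ) :
    ∑ k ∈ range (n + 1), q ^ k * q ^ k ^ 2 * invFac (q ^ 2) n k / qPoch (-(q * q)) q (2 * n) *
      ((-1) ^ k / qPoch (q ^ 2) (q ^ 2) k) = (1 + q) / qPoch (-q) q (2 * n + 1) := by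
  have hq2 := norm_sq_lt_one hq
  have cv := sum_qChuVandermonde hq2 n 0 (q ^ 2)
  rw [div_self (qPoch_ne_zero hq2 hq2 n)] at cv
  have h1 := one_add_ne_zero hq
  have e : (1 + q) / qPoch (-q) q (2 * n + 1) = 1 / qPoch (-(q * q)) q (2 * n) * 1 := by
    rw [qPoch_succ', sub_neg_eq_add, neg_mul, mul_one, ← div_div, div_self h1]
  rw [e]
  refine Eq.trans ?_ (congrArg (1 / qPoch (-(q * q)) q (2 * n) * ·) cv)
  rw [mul_sum]
  refine sum_congr rfl fun k hk => ?_
  rw [homPoch_zero_right, zero_mul, qPoch_zero_left, invFac,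
    if_pos (Nat.lt_succ_iff.mp (mem_range.mp hk)), ← two_mul_choose_two_add k]
  simp only [div_eq_mul_inv, mul_inv]
  ring

/-- The common source of the first two identities, with a = q and A = q²: d = D = 0 yields the
first, d = -q and D = -q² the second. The change-of-base factor is a^r q^{r²} itself, so only the
squared weights have to match. -/
theorem exists_hasSum_alternating {q d D : ℂ} (hq : ‖q‖ < 1) (hd : ‖d‖ < 1) (hD : ‖D‖ < 1)
    (hv : ∀ r, (baileyWeight q q d r / qPoch d q r) ^ 2 =
      baileyWeight (q ^ 2) (q ^ 2) D r / qPoch D (q ^ 2) r) :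
    ∃ S : ℂ,
      HasSum (fun x : ℕ × ℕ × ℕ => q ^ x.1 * q ^ x.1 ^ 2 * ((-1) ^ x.1 / qPoch (q ^ 2) (q ^ 2) x.1) *
        (baileyWeight q q d x.2.1 * baileyWeight q q d x.2.2 *
          (invFac q x.2.1 x.1 * invFac q x.2.2 x.1 / qPoch (q * q) q (x.2.1 + x.2.2))))
        ((qPochInf d q / qPochInf (q * q) q) ^ 2 * S) ∧
      HasSum (fun n => baileyWeight (q ^ 2) (q ^ 2) D n * ((1 + q) / qPoch (-q) q (2 * n + 1)))
        (qPochInf D (q ^ 2) / qPochInf (q ^ 2 * q ^ 2) (q ^ 2) * S) := by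
  have hq2 := norm_sq_lt_one hq
  obtain ⟨b, _, hb⟩ := exists_norm_inv_qPoch_le hq2 hq2
  exact exists_hasSum_triple_and_hasSum hq hq.le hd hq2 hq2.le hD
    (β := fun j => (-1) ^ j / qPoch (q ^ 2) (q ^ 2) j) (w := fun r => q ^ r * q ^ r ^ 2)
    (c := fun n k => q ^ k * q ^ k ^ 2 * invFac (q ^ 2) n k / qPoch (-(q * q)) q (2 * n))
    (fun n => by simpa [div_eq_mul_inv] using hb n)
    (norm_pow_mul_pow_sq_le hq hq.le)
    (fun n r _ => sum_baileyKer_changeBase hq hq.le n r)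
    (sum_alternating_changeBase hq) (fun r => by rw [hv])

theorem hasSum_term1 {q : ℂ} (hq : ‖q‖ < 1) :
    (Summable fun n : ℕ => q ^ (2 * n ^ 2 + 2 * n) / qPoch (-q) q (2 * n + 1)) ∧
      HasSum (fun x : ℕ × ℕ × ℕ => term1 q x.1 x.2.1 x.2.2)
        (qPochInf (-q) q / qPochInf q q *
          ∑' n : ℕ, q ^ (2 * n ^ 2 + 2 * n) / qPoch (-q) q (2 * n + 1)) := by
  have hq2 := norm_sq_lt_one hq
  have h1q := one_add_ne_zero hq
  have h1q' := one_sub_ne_zero hq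
  obtain ⟨S, hT, hR⟩ := exists_hasSum_alternating (d := 0) (D := 0) hq (by simp) (by simp)
    (fun r => by rw [baileyWeight_zero, baileyWeight_zero, qPoch_zero_left, qPoch_zero_left]; ring)
  have hR' : HasSum (fun n : ℕ => q ^ (2 * n ^ 2 + 2 * n) / qPoch (-q) q (2 * n + 1))
      ((1 + q)⁻¹ * (qPochInf 0 (q ^ 2) / qPochInf (q ^ 2 * q ^ 2) (q ^ 2) * S)) := by
    refine (hR.mul_left (1 + q)⁻¹).congr_fun fun n => ?_
    rw [baileyWeight_zero]
    field_simp
    ring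
  refine ⟨hR'.summable, ?_⟩
  rw [hR'.tsum_eq]
  -- The products match through (q²;q²)_∞ = (q)_∞(-q)_∞; the factors 1 ± q account for the shifted
  -- starting points q·q and q²·q².
  have hval : qPochInf (-q) q / qPochInf q q *
      ((1 + q)⁻¹ * (qPochInf 0 (q ^ 2) / qPochInf (q ^ 2 * q ^ 2) (q ^ 2) * S)) =
      (1 - q)⁻¹ * ((qPochInf 0 q / qPochInf (q * q) q) ^ 2 * S) := by
    have hX := qPochInf_ne_zero (norm_mul_lt_one hq hq.le) hq
    have hY := qPochInf_ne_zero (norm_mul_lt_one hq2 hq2.le) hq2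
    have h := qPochInf_sq hq q
    rw [qPochInf_succ hq2, qPochInf_succ hq q,
      show (1 - q ^ 2) * qPochInf (q ^ 2 * q ^ 2) (q ^ 2) =
        (1 - q) * ((1 + q) * qPochInf (q ^ 2 * q ^ 2) (q ^ 2)) by ring, mul_assoc] at h
    have h' := mul_left_cancel₀ h1q' h
    rw [qPochInf_zero_left, qPochInf_zero_left, qPochInf_succ hq q]
    generalize qPochInf (q * q) q = X at *
    generalize qPochInf (q ^ 2 * q ^ 2) (q ^ 2) = Y at *
    field_simp
    linear_combination -S * h'
  rw [hval]
  refine (hT.mul_left (1 - q)⁻¹).congr_fun fun x => ?_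
  rw [term1, recipQFac_sub, recipQFac_sub, baileyWeight_zero, baileyWeight_zero, qPoch_succ' q]
  simp only [div_eq_mul_inv, mul_inv]
  ring

theorem mul_succ_div_two (n : ℕ) : n * (n + 1) / 2 = n.choose 2 + n := by
  have := two_mul_choose_two_add n
  exact Nat.div_eq_of_eq_mul_right two_pos (by linarith)

theorem hasSum_term2 {q : ℂ} (hq : ‖q‖ < 1) :
    (Summable fun n : ℕ => q ^ (n ^ 2 + n) / qPoch (-q) (q ^ 2) (n + 1)) ∧
      HasSum (fun x : ℕ × ℕ × ℕ => term2 q x.1 x.2.1 x.2.2)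
        (qPochInf (-q) q * qPochInf (-q) (q ^ 2) / (qPochInf q q * qPochInf q (q ^ 2)) *
          ∑' n : ℕ, q ^ (n ^ 2 + n) / qPoch (-q) (q ^ 2) (n + 1)) := by
  have hq2 := norm_sq_lt_one hq
  have hnq : ‖-q‖ < 1 := by rwa [norm_neg]
  have hnq2 : ‖-q ^ 2‖ < 1 := by rwa [norm_neg]
  have h1q := one_add_ne_zero hq
  have h1q' := one_sub_ne_zero hq
  have hw : ∀ M, baileyWeight q q (-q) M = q ^ M * q ^ M.choose 2 * qPoch (-q) q M := fun M => by
    rw [baileyWeight_of_eq_mul (x := -q) (by ring), neg_neg]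
  have hW : ∀ M, baileyWeight (q ^ 2) (q ^ 2) (-q ^ 2) M =
      (q ^ 2) ^ M * (q ^ 2) ^ M.choose 2 * qPoch (-q ^ 2) (q ^ 2) M := fun M => by
    rw [baileyWeight_of_eq_mul (x := -q ^ 2) (by ring), neg_neg]
  obtain ⟨S, hT, hR⟩ := exists_hasSum_alternating (d := -q) (D := -q ^ 2) hq hnq hnq2
    (fun r => by
      rw [hw, hW, mul_div_cancel_right₀ _ (qPoch_ne_zero hnq hq r),
        mul_div_cancel_right₀ _ (qPoch_ne_zero hnq2 hq2 r)]
      ring)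
  have hR' : HasSum (fun n : ℕ => q ^ (n ^ 2 + n) / qPoch (-q) (q ^ 2) (n + 1))
      ((1 + q)⁻¹ * (qPochInf (-q ^ 2) (q ^ 2) / qPochInf (q ^ 2 * q ^ 2) (q ^ 2) * S)) := by
    refine (hR.mul_left (1 + q)⁻¹).congr_fun fun n => ?_
    rw [hW, qPoch_succ (-q) q, qPoch_two_mul, show -q * q = -q ^ 2 by ring, qPoch_succ,
      ← two_mul_choose_two_add n]
    have e1 := qPoch_ne_zero hnq2 hq2 n
    have e2 := qPoch_ne_zero hnq hq2 n
    have e3 := one_sub_mul_pow_ne_zero hnq hq2 n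
    have e4 : 1 - -q * q ^ (2 * n) = 1 - -q * (q ^ 2) ^ n := by rw [pow_mul]
    rw [e4]
    field_simp
    ring
  refine ⟨hR'.summable, ?_⟩
  rw [hR'.tsum_eq]
  -- Here the products match by splitting (q)_∞ and (-q)_∞ into even and odd exponents.
  have hval : qPochInf (-q) q * qPochInf (-q) (q ^ 2) / (qPochInf q q * qPochInf q (q ^ 2)) *
      ((1 + q)⁻¹ * (qPochInf (-q ^ 2) (q ^ 2) / qPochInf (q ^ 2 * q ^ 2) (q ^ 2) * S)) =
      (1 - q)⁻¹ * ((qPochInf (-q) q / qPochInf (q * q) q) ^ 2 * S) := by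
    have hB := qPochInf_ne_zero hq hq2
    have hY := qPochInf_ne_zero (norm_mul_lt_one hq2 hq2.le) hq2
    have hN := qPochInf_eq_mul_sq (-q) hq
    rw [show -q * q = -q ^ 2 by ring] at hN
    have h := qPochInf_eq_mul_sq q hq
    rw [← pow_two, qPochInf_succ hq2 (q ^ 2), qPochInf_succ hq q,
      show qPochInf q (q ^ 2) * ((1 - q ^ 2) * qPochInf (q ^ 2 * q ^ 2) (q ^ 2)) =
        (1 - q) * (qPochInf q (q ^ 2) * (1 + q) * qPochInf (q ^ 2 * q ^ 2) (q ^ 2)) by ring] at h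
    have h' := mul_left_cancel₀ h1q' h
    rw [qPochInf_succ hq q, hN, h']
    generalize qPochInf (q ^ 2 * q ^ 2) (q ^ 2) = Y at *
    field_simp
  rw [hval]
  refine (hT.mul_left (1 - q)⁻¹).congr_fun fun x => ?_
  rw [term2, recipQFac_sub, recipQFac_sub, hw, hw, qPoch_succ' q, mul_succ_div_two,
    mul_succ_div_two]
  simp only [div_eq_mul_inv, mul_inv]
  ring

/-! ### The third identity -/

/-- The sequence `(-1)^(j-1) (q;q²)_{j-1} / (q;q)_{2j-1}`, with value `0` at `j = 0`. -/
noncomputable def oddBeta (q : ℂ) : ℕ → ℂ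
  | 0 => 0
  | i + 1 => (-1) ^ i * qPoch q (q ^ 2) i / qPoch q q (2 * i + 1)

/-- The sequence `1 / ((-1;q)_n (q;q²)_n)` for `n ≥ 1`, with value `0` at `n = 0`. -/
noncomputable def oddBetaChanged (q : ℂ) : ℕ → ℂ
  | 0 => 0
  | n + 1 => 1 / (qPoch (-1) q (n + 1) * qPoch q (q ^ 2) (n + 1))

theorem exists_norm_oddBeta_le {q : ℂ} (hq : ‖q‖ < 1) : ∃ b : ℝ, ∀ n, ‖oddBeta q n‖ ≤ b := by
  obtain ⟨b₁, hb₁, h₁⟩ := exists_norm_qPoch_le q (norm_sq_lt_one hq)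
  obtain ⟨b₂, hb₂, h₂⟩ := exists_norm_inv_qPoch_le hq hq
  refine ⟨b₁ * b₂, fun n => ?_⟩
  cases n with
  | zero => simpa [oddBeta] using by positivity
  | succ i =>
    rw [oddBeta, div_eq_mul_inv, norm_mul, norm_mul, norm_pow, norm_neg, norm_one, one_pow, one_mul]
    gcongr
    · exact h₁ i
    · exact h₂ _

/-- Since the k = 0 term vanishes, put k = i + 1 and apply q-Chu–Vandermonde in base q² at C = q³, D
= q², where the right-hand side is 1. -/
theorem sum_oddBeta_changeBase {q : ℂ} (hq : ‖q‖ < 1) (n : ℕ) :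
    ∑ k ∈ range (n + 1), q ^ (2 * k.choose 2) * invFac (q ^ 2) n k / qPoch (-1) q (2 * n) *
      oddBeta q k = oddBetaChanged (q ^ 2) n := by
  cases n with
  | zero => simp [oddBeta, oddBetaChanged]
  | succ n =>
    have hq2 := norm_sq_lt_one hq
    rw [sum_range_succ']
    simp only [oddBeta, mul_zero, add_zero]
    have cv := sum_qChuVandermonde hq2 n (q ^ 2 * q) (q ^ 2)
    rw [div_self (qPoch_ne_zero hq2 hq2 n)] at cv
    have hn : qPoch q (q ^ 2) (n + 1) ≠ 0 := qPoch_ne_zero hq hq2 _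
    have e : oddBetaChanged (q ^ 2) (n + 1) =
        1 / (qPoch (-1) q (2 * (n + 1)) * qPoch q (q ^ 2) (n + 1)) * 1 := by
      rw [oddBetaChanged, qPoch_sq q, qPoch_two_mul, neg_one_mul, mul_one]
      ring
    rw [e]
    refine Eq.trans ?_ (congrArg
      (1 / (qPoch (-1) q (2 * (n + 1)) * qPoch q (q ^ 2) (n + 1)) * ·) cv)
    rw [mul_sum]
    refine sum_congr rfl fun i hi => ?_
    obtain ⟨k, rfl⟩ := Nat.exists_eq_add_of_le (Nat.lt_succ_iff.mp (mem_range.mp hi))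
    have e1 : invFac (q ^ 2) (i + k + 1) (i + 1) = (qPoch (q ^ 2) (q ^ 2) k)⁻¹ := by
      rw [add_right_comm, invFac_add_left]
    have e2 : qPoch q (q ^ 2) (i + k + 1) = qPoch q (q ^ 2) i * (1 - q * (q ^ 2) ^ i) *
        qPoch (q ^ 2 * q * (q ^ 2) ^ i) (q ^ 2) k := by
      rw [add_right_comm, qPoch_add, qPoch_succ]
      congr 2; ring
    have e3 : qPoch q q (2 * i + 1) =
        qPoch q (q ^ 2) i * qPoch (q ^ 2) (q ^ 2) i * (1 - q * (q ^ 2) ^ i) := by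
      rw [qPoch_succ, qPoch_two_mul, ← pow_two, pow_mul]
    rw [e1, e3, homPoch_eq_qPoch, choose_two_succ, Nat.add_sub_cancel_left]
    rw [e2] at hn ⊢
    have f1 := right_ne_zero_of_mul hn
    have f2 := left_ne_zero_of_mul (left_ne_zero_of_mul hn)
    have f3 := right_ne_zero_of_mul (left_ne_zero_of_mul hn)
    have f4 := qPoch_ne_zero hq2 hq2 i
    have f5 := qPoch_ne_zero hq2 hq2 k
    generalize qPoch (q ^ 2 * q * (q ^ 2) ^ i) (q ^ 2) k = X at *
    generalize qPoch (-1) q (2 * (i + k + 1)) = Y at *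
    field_simp
    ring

theorem qPoch_neg_one_mul (q : ℂ) (r : ℕ) :
    qPoch (-1) q r * (1 + q ^ r) = 2 * qPoch (-q) q r := by
  have := qPoch_succ (-1) q r
  rw [qPoch_succ', neg_one_mul] at this
  linear_combination -this

theorem norm_halfWeight_le {q : ℂ} (hq : ‖q‖ < 1) (r : ℕ) :
    ‖q ^ (2 * r.choose 2) * (1 + q ^ (2 * r)) / 2‖ ≤ ‖q‖ ^ r.choose 2 := by
  have h1 : ‖(1 + q ^ (2 * r)) / 2‖ ≤ 1 := by
    rw [norm_div, Complex.norm_ofNat, div_le_one two_pos]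
    refine (norm_add_le _ _).trans ?_
    rw [norm_one, norm_pow]
    linarith [pow_le_one₀ (n := 2 * r) (norm_nonneg q) hq.le]
  rw [mul_div_assoc, norm_mul, norm_pow]
  refine (mul_le_of_le_one_right (by positivity) h1).trans ?_
  exact pow_le_pow_of_le_one (norm_nonneg _) hq.le (by omega)

theorem term3_eq (q : ℂ) (j n₁ n₂ : ℕ) :
    term3 q j n₁ n₂ = (q ^ 2) ^ j ^ 2 * oddBeta (q ^ 2) j *
      (((-q) ^ n₁ * (q ^ 2) ^ n₁.choose 2 * qPoch q (q ^ 2) n₁) *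
        ((-q) ^ n₂ * (q ^ 2) ^ n₂.choose 2 * qPoch q (q ^ 2) n₂) *
        (invFac (q ^ 2) n₁ j * invFac (q ^ 2) n₂ j / qPoch (q ^ 2) (q ^ 2) (n₁ + n₂))) := by
  rw [term3, recipQFac_sub, recipQFac_sub]
  cases j with
  | zero =>
    have : recipQFac (q ^ 2) (2 * ((0 : ℕ) : ℤ) - 1) = 0 := rfl
    rw [this, oddBeta]; ring
  | succ i =>
    have h1 : recipQFac (q ^ 2) (2 * ((i + 1 : ℕ) : ℤ) - 1) = 1 / qPoch (q ^ 2) (q ^ 2) (2 * i + 1) := by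
      rw [show 2 * ((i + 1 : ℕ) : ℤ) - 1 = Int.ofNat (2 * i + 1) by
        rw [Int.ofNat_eq_natCast]; push_cast; ring]
      rfl
    have h2 : qPochInt (q ^ 2) (q ^ 4) (((i + 1 : ℕ) : ℤ) - 1) = qPoch (q ^ 2) (q ^ 4) i := by
      rw [show ((i + 1 : ℕ) : ℤ) - 1 = Int.ofNat i by rw [Int.ofNat_eq_natCast]; push_cast; ring]
      rfl
    have h3 : (-1 : ℂ) ^ ((n₁ : ℤ) + n₂ + ((i + 1 : ℕ) : ℤ) - 1) = (-1) ^ (n₁ + n₂ + i) := by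
      rw [← zpow_natCast]; congr 1; push_cast; ring
    rw [h1, h2, h3, oddBeta, ← two_mul_choose_two_add n₁, ← two_mul_choose_two_add n₂,
      show q ^ 4 = (q ^ 2) ^ 2 by ring, neg_pow q n₁, neg_pow q n₂]
    simp only [div_eq_mul_inv]
    ring

theorem hasSum_term3 {q : ℂ} (hq : ‖q‖ < 1) :
    (Summable fun m : ℕ => psiTerm (q ^ 4) m) ∧
      HasSum (fun x : ℕ × ℕ × ℕ => term3 q x.1 x.2.1 x.2.2)
        (qPochInf q (q ^ 2) ^ 2 * qPochInf (q ^ 4) (q ^ 4) /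
            (qPochInf (q ^ 2) (q ^ 2) ^ 2 * qPochInf (-q ^ 4) (q ^ 4)) * psi (q ^ 4)) := by
  have hq2 := norm_sq_lt_one hq
  rw [show q ^ 4 = (q ^ 2) ^ 2 by ring]
  set Q := q ^ 2 with hQ
  set P := Q ^ 2 with hP
  have hP1 : ‖P‖ < 1 := norm_sq_lt_one hq2
  have hnP : ‖-P‖ < 1 := by rwa [norm_neg]
  have hw : ∀ M, baileyWeight Q 1 q M = (-q) ^ M * Q ^ M.choose 2 * qPoch q Q M := fun M =>
    baileyWeight_of_eq_mul (by rw [hQ]; ring) M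
  have hW : ∀ M, baileyWeight P 1 (-P) M = P ^ M * P ^ M.choose 2 * qPoch (-1) P M := fun M => by
    rw [baileyWeight_of_eq_mul (x := -1) (by ring), neg_neg]
  obtain ⟨b, hb⟩ := exists_norm_oddBeta_le hq2
  obtain ⟨S, hT, hR⟩ := exists_hasSum_triple_and_hasSum (a := 1) (A := 1) (D := -P) hq2 (by simp) hq
    hP1 (by simp) hnP hb (norm_halfWeight_le hq2)
    (fun n r hr => sum_baileyKer_one_changeBase hq2 n (fun h => hr h rfl))
    (sum_oddBeta_changeBase hq2)
    (fun r => by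
      rw [hw, hW, mul_div_cancel_right₀ _ (qPoch_ne_zero hq hq2 r)]
      have h1 := qPoch_ne_zero hnP hP1 r
      have h2 := qPoch_neg_one_mul P r
      -- The factor (1 + Q^{2r})/2 = (1 + P^r)/2 is what turns (-1;P)_r into (-P;P)_r and cancels
      -- the denominator.
      have h3 : Q ^ (2 * r.choose 2) * (1 + Q ^ (2 * r)) / 2 *
          (P ^ r * P ^ r.choose 2 * qPoch (-1) P r / qPoch (-P) P r) =
          Q ^ (2 * r.choose 2) * P ^ r * P ^ r.choose 2 *
          ((qPoch (-1) P r * (1 + P ^ r)) / (2 * qPoch (-P) P r)) := by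
        rw [hP, ← pow_mul Q 2 r]; field_simp
      rw [h3, h2, div_self (mul_ne_zero two_ne_zero h1), ← two_mul_choose_two_add r, hP, hQ,
        show ((-q) ^ r * (q ^ 2) ^ r.choose 2) ^ 2 = ((-q) ^ 2) ^ r * (q ^ 2) ^ (2 * r.choose 2) by
          rw [mul_pow, ← pow_mul, mul_comm r 2, pow_mul, ← pow_mul _ (r.choose 2) 2,
            mul_comm (r.choose 2) 2], neg_sq]
      ring)
  have hpsi : HasSum (psiTerm P) (qPochInf (-P) P / qPochInf (1 * P) P * S) := by
    -- The term n = 0 is zero, so dropping it aligns the series with ψ, which starts at n = 1.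
    rw [← hasSum_nat_add_iff' 1] at hR
    simp only [sum_range_one, oddBetaChanged, mul_zero, sub_zero, ← hP] at hR
    refine hR.congr_fun fun n => ?_
    have h0 : qPoch (-1) P (n + 1) ≠ 0 := by
      rw [qPoch_succ', neg_one_mul]
      exact mul_ne_zero (by norm_num) (qPoch_ne_zero hnP hP1 n)
    have h1 := qPoch_ne_zero hP1 (norm_sq_lt_one hP1) (n + 1)
    rw [hW, psiTerm, mul_succ_div_two (n + 1), pow_add]
    field_simp
  refine ⟨hpsi.summable, ?_⟩
  rw [psi, hpsi.tsum_eq]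
  have hval : qPochInf q Q ^ 2 * qPochInf P P / (qPochInf Q Q ^ 2 * qPochInf (-P) P) *
      (qPochInf (-P) P / qPochInf (1 * P) P * S) =
      (qPochInf q Q / qPochInf (1 * Q) Q) ^ 2 * S := by
    have h1 := qPochInf_ne_zero hP1 hP1
    have h2 := qPochInf_ne_zero hnP hP1
    rw [one_mul, one_mul]
    field_simp
  rw [hval]
  refine hT.congr_fun fun x => ?_
  rw [term3_eq, ← hQ, hw, hw, one_pow, one_mul, one_mul]

end MixedMock

theorem theorem2 (q : ℂ) (hq : ‖q‖ < 1) :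
    ((Summable fun n : ℕ => q ^ (2 * n ^ 2 + 2 * n) / MixedMock.qPoch (-q) q (2 * n + 1)) ∧
      HasSum (fun x : ℕ × ℕ × ℕ => MixedMock.term1 q x.1 x.2.1 x.2.2)
        (MixedMock.qPochInf (-q) q / MixedMock.qPochInf q q *
          ∑' n : ℕ, q ^ (2 * n ^ 2 + 2 * n) / MixedMock.qPoch (-q) q (2 * n + 1))) ∧
    ((Summable fun n : ℕ => q ^ (n ^ 2 + n) / MixedMock.qPoch (-q) (q ^ 2) (n + 1)) ∧
      HasSum (fun x : ℕ × ℕ × ℕ => MixedMock.term2 q x.1 x.2.1 x.2.2)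
        (MixedMock.qPochInf (-q) q * MixedMock.qPochInf (-q) (q ^ 2) /
            (MixedMock.qPochInf q q * MixedMock.qPochInf q (q ^ 2)) *
          ∑' n : ℕ, q ^ (n ^ 2 + n) / MixedMock.qPoch (-q) (q ^ 2) (n + 1))) ∧
    ((Summable fun m : ℕ => MixedMock.psiTerm (q ^ 4) m) ∧
      HasSum (fun x : ℕ × ℕ × ℕ => MixedMock.term3 q x.1 x.2.1 x.2.2)
        (MixedMock.qPochInf q (q ^ 2) ^ 2 * MixedMock.qPochInf (q ^ 4) (q ^ 4) /
            (MixedMock.qPochInf (q ^ 2) (q ^ 2) ^ 2 * MixedMock.qPochInf (-q ^ 4) (q ^ 4)) *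
          MixedMock.psi (q ^ 4))) :=
  ⟨MixedMock.hasSum_term1 hq, MixedMock.hasSum_term2 hq, MixedMock.hasSum_term3 hq⟩
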